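/- A \emph{semilattice} is an algebra $(S;\wedge)$ with one binary operation that is associative, commutative and idempotent. Let $\mathfrak U$ be the countable universal homogeneous semilattice, i.e. the (up to isomorphism unique) Fra\"{i}ss\'e limit of the class of all finite semilattices. An instance of $\mathrm{CSP}(\mathfrak U,\neq)$ is a finite conjunction of formulas $s=t$ and $s\neq t$, where $s,t$ are $\wedge$-terms over variables $x_0,x_1,\dots$ (written as a word over a finite alphabet, terms in prefix notation and indices of variables in binary); the question is whether some assignment of elements of $\mathfrak U$ to the variables satisfies all the formulas. \textbf{Proposition.} $\mathrm{CSP}(\mathfrak U,\neq)$ can be solved in polynomial time: a deterministic Turing machine decides it in a number of steps bounded by a polynomial in the length of the input word. Moreover: (a) A conjunction $\psi\wedge s_1\neq t_1\wedge\dots\wedge s_m\neq t_m$ with $m\ge 0$, where $\psi$ is a finite conjunction of equations between terms, is satisfiable in $\mathfrak U$ if and only if $\psi\wedge s_i\neq t_i$ is satisfiable in $\mathfrak U$ for each $i\in\{1,\dots,m\}$. (b) If $\psi$ is a finite conjunction of equations between terms and $s,t$ are terms, then $\psi\wedge s\neq t$ is satisfiable in $\mathfrak U$ if and only if $\psi\wedge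 s=0\wedge t=1$ or $\psi\wedge s=1\wedge t=0$ is satisfiable in the two-element semilattice $(\{0,1\};\wedge,0,1)$. -/

import Mathlib

namespace SemilatticeCSP

universe w

open FirstOrder

/-! ### Semilattices as algebras with one binary operation -/

/-- The function symbols of the signature of semilattices: one binary symbol. -/
inductive MeetSymbol : ℕ → Type
  | meet : MeetSymbol 2

/-- The signature `{∧}` of semilattices; it is purely functional. -/
def meetLang : FirstOrder.Language.{0, 0} := ⟨MeetSymbol, fun _ => Empty⟩

instance : Countable (Σ n, meetLang.Functions n) :=
  Function.Injective.countable (f := fun _ => ()) (by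
    rintro ⟨_, ⟨⟩⟩ ⟨_, ⟨⟩⟩ _
    rfl)

/-- The binary operation of a `{∧}`-structure. -/
def meet {S : Type*} [meetLang.Structure S] (a b : S) : S :=
  FirstOrder.Language.Structure.funMap (L := meetLang) MeetSymbol.meet ![a, b]

/-- `(S; ∧)` is a semilattice: `∧` is associative, commutative and idempotent. -/
structure IsSemilattice (S : Type*) [meetLang.Structure S] : Prop where
  assoc : ∀ a b c : S, meet (meet a b) c = meet a (meet b c)
  comm : ∀ a b : S, meet a b = meet b a
  idem : ∀ a : S, meet a a = a

/-- The class of all finite semilattices. -/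
def finiteSemilattices : Set (CategoryTheory.Bundled.{w} meetLang.Structure) :=
  {S | Finite S ∧ IsSemilattice S}

/-- The two-element semilattice on `{0, 1}`, with `0 = false`, `1 = true`. -/
instance : meetLang.Structure Bool where
  funMap := fun f v => match f, v with
    | MeetSymbol.meet, v => v 0 && v 1
  RelMap := fun r _ => nomatch r

/-! ### The constraint satisfaction problem of `(𝔄, ≠)` -/

/-- Atomic formulas `s = t` and `s ≠ t`, where `s` and `t` are terms over the variables
`x₀, x₁, …`. -/
inductive Constraint (L : FirstOrder.Language.{0, 0}) : Type
  | eq (s t : L.Term ℕ)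
  | ne (s t : L.Term ℕ)

/-- Truth of an atomic formula in `(A, ≠)` under an assignment of the variables. -/
def Constraint.Holds {L : FirstOrder.Language.{0, 0}} {A : Type*} [L.Structure A] (v : ℕ → A) :
    Constraint L → Prop
  | .eq s t => s.realize v = t.realize v
  | .ne s t => s.realize v ≠ t.realize v

/-- A finite conjunction of atomic formulas is satisfiable in `(A, ≠)`. -/
def Satisfiable {L : FirstOrder.Language.{0, 0}} (A : Type*) [L.Structure A]
    (φ : List (Constraint L)) : Prop :=
  ∃ v : ℕ → A, ∀ c ∈ φ, c.Holds v

/-! ### Instances as words, and polynomial time -/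

/-- The alphabet in which instances are written. -/
inductive Letter : Type
  | meet | eq | ne | var
  | bit (b : Bool)
  deriving DecidableEq, Fintype

/-- Terms in prefix notation; the variable `xₙ` is the letter `var` followed by the binary
representation of `n`. -/
def encodeTerm : meetLang.Term ℕ → List Letter
  | .var n => .var :: (Computability.encodeNat n).map .bit
  | .func (l := _) f ts => match f, ts with
    | MeetSymbol.meet, ts => .meet :: (encodeTerm (ts 0) ++ encodeTerm (ts 1))

/-- Atomic formulas in prefix notation. -/
def encodeConstraint : Constraint meetLang → List Letter
  | .eq s t => .eq :: (encodeTerm s ++ encodeTerm t)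
  | .ne s t => .ne :: (encodeTerm s ++ encodeTerm t)

/-- The word of an instance: the words of its atomic formulas, one after the other. -/
def encodeInstance (φ : List (Constraint meetLang)) : List Letter :=
  φ.flatMap encodeConstraint

/-- The problem `P`, whose instances `a` are presented as the words `enc a`, is decided by a
Turing machine in a number of steps bounded by a polynomial in the length of `enc a`. -/
def DecidableInPolyTime {α Γ : Type} (enc : α → List Γ) (P : α → Prop) : Prop :=
  ∃ f : α → Bool, (∀ a, f a = true ↔ P a) ∧
    Nonempty (Turing.TM2ComputableInPolyTime enc Computability.encodeBool f)

end SemilatticeCSP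

/-! ### Stack programs whose memory never grows -/

/-! Algebra. For a fixed element `e` of a semilattice, `x ↦ [e ≤ x]` is a homomorphism to `{0,1}`,
and if `s ≠ t` then `e = s` or `e = t` separates the two values. Hence a solution in the limit
yields, for every disequality, a 0/1 solution of the equations that separates its sides. Conversely,
0/1 solutions, one for each disequality, are the coordinates of a solution in a finite power of
`{0,1}`, and this power embeds in the limit, whose age consists of all finite semilattices. This is
`satisfiable_iff`. In that criterion the disequalities do not interact, which gives (a) and (b).

Decision. A term has value 1 iff all its variables do, so an equation is a pair of Horn rules: all
variables of one side imply all variables of the other. The sides of `s ≠ t` cannot be separated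
exactly when the closure started from the variables of either side derives those of the other
(`not_entails_iff`, `Entails.der`). Both closures run at once, every occurrence of a variable
carrying one mark per direction.

Machine. The algorithm is written in a small language of loops over stacks. A loop consumes a stack
that it never refills, and pushes are paid for by the weight of the letter popped before. The total
weight never grows, so every loop makes at most linearly many passes, and structural induction gives
a polynomial time bound (`Prog.weight_den_le`, `Prog.steps_code`, `computableInPolyTime`).
`den_solve` identifies the effect of the program with a function on formulas, and `solve_bad`
connects that function with satisfiability. -/

namespace StackProg

open Turing Function

section Programs

variable {K : Type} (Γ : K → Type) (σ : Type)

/-- What is pushed after a letter of type `A` has been removed from a stack. -/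
inductive Emit (A : Type) : Type
  | nil
  | push (k : K) (f : σ → A → Γ k) (e : Emit A)
  | br (c : σ → A → Bool) (e₁ e₂ : Emit A)

/-- Programs over stacks. `act` pops a letter once, and `drain` pops letters from a stack until it
is empty, running its body after each of them. -/
inductive Prog : Type
  | load (g : σ → σ)
  | act (k : K) (g₀ : σ → σ) (g : σ → Γ k → σ) (e : Emit Γ σ (Γ k))
  | seq (p q : Prog)
  | ite (c : σ → Bool) (p q : Prog)
  | drain (k : K) (g : σ → Γ k → σ) (e : Emit Γ σ (Γ k)) (p : Prog)

end Programs

variable {K : Type} [DecidableEq K] {Γ : K → Type} {σ : Type}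

/-- The effect of an `Emit` on the stacks. -/
def Emit.run {A : Type} (v : σ) (a : A) : Emit Γ σ A → (∀ k, List (Γ k)) → ∀ k, List (Γ k)
  | .nil, S => S
  | .push k f e, S => e.run v a (update S k (f v a :: S k))
  | .br c e₁ e₂, S => cond (c v a) (e₁.run v a S) (e₂.run v a S)

/-- The largest total weight that an `Emit` can push. -/
def Emit.cost {A : Type} (w : K → ℕ) : Emit Γ σ A → ℕ
  | .nil => 0
  | .push k _ e => w k + e.cost w
  | .br _ e₁ e₂ => max (e₁.cost w) (e₂.cost w)

/-- An `Emit` does not push to the stack `k`. -/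
def Emit.avoids {A : Type} (k : K) : Emit Γ σ A → Bool
  | .nil => true
  | .push k' _ e => !decide (k = k') && e.avoids k
  | .br _ e₁ e₂ => e₁.avoids k && e₂.avoids k

/-- Iterate the body `f` of a loop over the stack `k`, at most `n` times. -/
def drainIter (k : K) (g : σ → Γ k → σ) (e : Emit Γ σ (Γ k))
    (f : σ × (∀ k, List (Γ k)) → σ × (∀ k, List (Γ k))) :
    ℕ → σ × (∀ k, List (Γ k)) → σ × (∀ k, List (Γ k))
  | 0, s => s
  | n + 1, s => match s.2 k with
    | [] => s
    | a :: l => drainIter k g e f n (f (g s.1 a, e.run s.1 a (update s.2 k l)))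

/-- The denotation of a program. -/
def Prog.den : Prog Γ σ → σ × (∀ k, List (Γ k)) → σ × (∀ k, List (Γ k))
  | .load g, s => (g s.1, s.2)
  | .act k g₀ g e, s => match s.2 k with
    | [] => (g₀ s.1, s.2)
    | a :: l => (g s.1 a, e.run s.1 a (update s.2 k l))
  | .seq p q, s => q.den (p.den s)
  | .ite c p q, s => cond (c s.1) (p.den s) (q.den s)
  | .drain k g e p, s => drainIter k g e p.den (s.2 k).length s

/-- A program does not push to the stack `k`. -/
def Prog.avoids (k : K) : Prog Γ σ → Bool
  | .load _ => true
  | .act _ _ _ e => e.avoids k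
  | .seq p q => p.avoids k && q.avoids k
  | .ite _ p q => p.avoids k && q.avoids k
  | .drain _ _ e p => e.avoids k && p.avoids k

/-- Every loop consumes its stack, and the letters that are pushed are paid for by the weight of the
letter popped before. -/
def Prog.wf (w : K → ℕ) : Prog Γ σ → Bool
  | .load _ => true
  | .act k _ _ e => decide (e.cost w ≤ w k)
  | .seq p q => p.wf w && q.wf w
  | .ite _ p q => p.wf w && q.wf w
  | .drain k _ e p => decide (e.cost w ≤ w k) && e.avoids k && p.avoids k && p.wf w

/-! #### Loops -/

theorem Emit.length_run_le {A : Type} (v : σ) (a : A) (k : K) (e : Emit Γ σ A)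
    (h : e.avoids k = true) (S : ∀ k, List (Γ k)) : (e.run v a S k).length = (S k).length := by
  induction e generalizing S with
  | nil => rfl
  | push k' f e ih =>
    simp only [avoids, Bool.and_eq_true, Bool.not_eq_true', decide_eq_false_iff_not] at h
    simp [run, ih h.2, update_of_ne h.1]
  | br c e₁ e₂ ih₁ ih₂ =>
    simp only [avoids, Bool.and_eq_true] at h
    cases hc : c v a <;> simp [run, hc, ih₁ h.1, ih₂ h.2]

theorem length_drainIter_le (j k : K) (g : σ → Γ k → σ) (e : Emit Γ σ (Γ k))
    (he : e.avoids j = true) (f : σ × (∀ k, List (Γ k)) → σ × (∀ k, List (Γ k)))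
    (hf : ∀ s, ((f s).2 j).length ≤ (s.2 j).length) (n : ℕ) (s : σ × (∀ k, List (Γ k))) :
    ((drainIter k g e f n s).2 j).length ≤ (s.2 j).length := by
  induction n generalizing s with
  | zero => exact le_rfl
  | succ n ih =>
    unfold drainIter
    split
    · exact le_rfl
    · next a l hk =>
      refine (ih _).trans ((hf _).trans ?_)
      simp only [Emit.length_run_le _ _ _ _ he]
      by_cases hjk : j = k
      · subst hjk; simp [hk]
      · simp [update_of_ne hjk]

theorem Prog.length_den_le (k : K) (p : Prog Γ σ) (h : p.avoids k = true)
    (s : σ × (∀ k, List (Γ k))) : ((p.den s).2 k).length ≤ (s.2 k).length := by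
  induction p generalizing s with
  | load g => exact le_rfl
  | act j g₀ g e =>
    simp only [den]
    split
    · exact le_rfl
    · next a l hk =>
      simp only [Emit.length_run_le _ _ _ _ h]
      by_cases hjk : k = j
      · subst hjk; simp [hk]
      · simp [update_of_ne hjk]
  | seq p q ihp ihq =>
    simp only [avoids, Bool.and_eq_true] at h
    exact (ihq h.2 _).trans (ihp h.1 _)
  | ite c p q ihp ihq =>
    simp only [avoids, Bool.and_eq_true] at h
    cases hc : c s.1 <;> simp [den, hc, ihp h.1, ihq h.2]
  | drain j g e p ih =>
    simp only [avoids, Bool.and_eq_true] at h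
    exact length_drainIter_le _ _ _ _ h.1 _ (ih h.2) _ _

/-- Every pass starts with a pop from `k` and pushes nothing back, so the height of `k` strictly
falls and all fuels that cover it give the same result. The induction is strong because the body may
pop further letters from `k`. -/
theorem drainIter_eq (k : K) (g : σ → Γ k → σ) (e : Emit Γ σ (Γ k)) (he : e.avoids k = true)
    (f : σ × (∀ k, List (Γ k)) → σ × (∀ k, List (Γ k)))
    (hf : ∀ s, ((f s).2 k).length ≤ (s.2 k).length) (n : ℕ) (s : σ × (∀ k, List (Γ k)))
    (hn : (s.2 k).length ≤ n) :
    drainIter k g e f n s = drainIter k g e f (s.2 k).length s := by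
  induction n using Nat.strong_induction_on generalizing s with
  | _ n ih =>
    cases hk : s.2 k with
    | nil => cases n <;> simp [drainIter, hk]
    | cons a l =>
      obtain _ | n := n
      · simp [hk] at hn
      have hlen := hf (g s.1 a, e.run s.1 a (update s.2 k l))
      simp only [Emit.length_run_le _ _ _ _ he, update_self] at hlen
      simp only [hk, List.length_cons, Nat.add_le_add_iff_right] at hn
      simp only [drainIter, hk, List.length_cons]
      rw [ih n (Nat.lt_succ_self _) _ (hlen.trans hn)]
      rcases hn.lt_or_eq with h | h
      · rw [ih l.length (Nat.lt_succ_of_lt h) _ hlen]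
      · rw [h, ih n (Nat.lt_succ_self _) _ (hlen.trans hn)]

theorem Prog.den_drain_nil (k : K) (g : σ → Γ k → σ) (e : Emit Γ σ (Γ k)) (p : Prog Γ σ)
    (v : σ) (S : ∀ k, List (Γ k)) (h : S k = []) :
    (Prog.drain k g e p).den (v, S) = (v, S) := by
  simp [den, h, drainIter]

/-- The recursion equation of the loop, free of fuel. Together with `den_drain_nil` it is the form
in which concrete programs are evaluated. -/
theorem Prog.den_drain_cons (k : K) (g : σ → Γ k → σ) (e : Emit Γ σ (Γ k)) (p : Prog Γ σ)
    (he : e.avoids k = true) (hp : p.avoids k = true)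
    (v : σ) (S : ∀ k, List (Γ k)) (a : Γ k) (l : List (Γ k)) (h : S k = a :: l) :
    (Prog.drain k g e p).den (v, S) =
      (Prog.drain k g e p).den (p.den (g v a, e.run v a (update S k l))) := by
  simp only [den, h, List.length_cons, drainIter]
  refine drainIter_eq _ _ _ he _ (p.length_den_le k hp) _ _ ?_
  refine (p.length_den_le k hp _).trans ?_
  simp [Emit.length_run_le _ _ _ _ he]

/-- The index `n` bounds the passes still to come. It is not tied to the height of `k`, which may
drop by more than one in a pass; in the time bound it becomes the factor counting passes. -/
theorem Prog.drain_induction (k : K) (g : σ → Γ k → σ) (e : Emit Γ σ (Γ k)) (p : Prog Γ σ)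
    (he : e.avoids k = true) (hp : p.avoids k = true)
    {P : ℕ → σ × (∀ k, List (Γ k)) → Prop}
    (nil : ∀ n s, s.2 k = [] → P n s)
    (cons : ∀ n s a l, s.2 k = a :: l →
      P n (p.den (g s.1 a, e.run s.1 a (update s.2 k l))) → P (n + 1) s)
    (n : ℕ) (s : σ × (∀ k, List (Γ k))) (h : (s.2 k).length ≤ n) : P n s := by
  induction n generalizing s with
  | zero => exact nil _ _ (by simpa using h)
  | succ n ih =>
    cases hk : s.2 k with
    | nil => exact nil _ _ hk
    | cons a l =>
      refine cons _ _ _ _ hk (ih _ ?_)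
      refine (p.length_den_le k hp _).trans ?_
      simpa [Emit.length_run_le _ _ _ _ he, hk] using h

/-! #### Weights -/

section Weight

variable [Fintype K] (w : K → ℕ)

/-- The total weight of the letters on the stacks. -/
def weight (S : ∀ k, List (Γ k)) : ℕ := ∑ k, w k * (S k).length

/-- Stated additively to avoid subtraction in `ℕ`. -/
theorem weight_update (S : ∀ k, List (Γ k)) (k : K) (l : List (Γ k)) :
    weight w (update S k l) + w k * (S k).length = weight w S + w k * l.length := by
  unfold weight
  rw [← Finset.add_sum_erase _ _ (Finset.mem_univ k),
    ← Finset.add_sum_erase (a := k) _ (fun j => w j * (S j).length) (Finset.mem_univ k),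
    Finset.sum_congr rfl (g := fun j => w j * (S j).length)]
  · simp only [update_self]; ring
  · intro j hj
    rw [update_of_ne (Finset.ne_of_mem_erase hj)]

omit [DecidableEq K] in
theorem length_le_weight (hw : ∀ k, 1 ≤ w k) (S : ∀ k, List (Γ k)) (k : K) :
    (S k).length ≤ weight w S :=
  (Nat.le_mul_of_pos_left _ (hw k)).trans
    (Finset.single_le_sum (f := fun k => w k * (S k).length) (fun _ _ => Nat.zero_le _)
      (Finset.mem_univ k))

theorem Emit.weight_run_le {A : Type} (v : σ) (a : A) (e : Emit Γ σ A) (S : ∀ k, List (Γ k)) :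
    weight w (e.run v a S) ≤ weight w S + e.cost w := by
  induction e generalizing S with
  | nil => exact Nat.le_add_right _ _
  | push k f e ih =>
    refine (ih _).trans ?_
    have := weight_update w S k (f v a :: S k)
    simp only [List.length_cons, cost] at this ⊢
    linarith
  | br c e₁ e₂ ih₁ ih₂ =>
    simp only [run, cost]
    cases c v a
    · exact (ih₂ S).trans (by simp)
    · exact (ih₁ S).trans (by simp)

theorem Emit.weight_run_update_le {k : K} (v : σ) (a : Γ k) (l : List (Γ k)) (e : Emit Γ σ (Γ k))
    (he : e.cost w ≤ w k) (S : ∀ k, List (Γ k)) (h : S k = a :: l) :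
    weight w (e.run v a (update S k l)) ≤ weight w S := by
  refine (e.weight_run_le w v a _).trans ?_
  have := weight_update w S k l
  simp only [h, List.length_cons] at this
  linarith

/-- A popped letter releases weight `w k`, the `Emit` that follows costs no more, and nothing else
pushes. So the initial weight bounds the memory throughout the run. -/
theorem Prog.weight_den_le (p : Prog Γ σ) (h : p.wf w = true) (s : σ × (∀ k, List (Γ k))) :
    weight w (p.den s).2 ≤ weight w s.2 := by
  induction p generalizing s with
  | load g => exact le_rfl
  | act k g₀ g e =>
    simp only [wf, decide_eq_true_eq] at h
    simp only [den]
    split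
    · exact le_rfl
    · next a l hk => exact Emit.weight_run_update_le w _ _ _ _ h _ hk
  | seq p q ihp ihq =>
    simp only [wf, Bool.and_eq_true] at h
    exact (ihq h.2 _).trans (ihp h.1 _)
  | ite c p q ihp ihq =>
    simp only [wf, Bool.and_eq_true] at h
    cases hc : c s.1 <;> simp [den, hc, ihp h.1, ihq h.2]
  | drain k g e p ih =>
    simp only [wf, Bool.and_eq_true, decide_eq_true_eq] at h
    simp only [den]
    generalize (s.2 k).length = n
    induction n generalizing s with
    | zero => exact le_rfl
    | succ n ihn =>
      unfold drainIter
      split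
      · exact le_rfl
      · next a l hk =>
        exact (ihn _).trans ((ih h.2 _).trans (Emit.weight_run_update_le w _ _ _ _ h.1.1.1 _ hk))

end Weight

/-! #### Compilation to Turing machines -/

/-- The labels of a compiled program. -/
def Prog.Lab : Prog Γ σ → Type
  | .load _ => Unit
  | .act _ _ _ _ => Unit
  | .seq p q => p.Lab ⊕ q.Lab
  | .ite _ p q => Option (p.Lab ⊕ q.Lab)
  | .drain _ _ _ p => Option p.Lab

instance Prog.fintypeLab : (p : Prog Γ σ) → Fintype p.Lab
  | .load _ => inferInstanceAs (Fintype Unit)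
  | .act _ _ _ _ => inferInstanceAs (Fintype Unit)
  | .seq p q =>
    letI := p.fintypeLab; letI := q.fintypeLab; inferInstanceAs (Fintype (p.Lab ⊕ q.Lab))
  | .ite _ p q =>
    letI := p.fintypeLab; letI := q.fintypeLab; inferInstanceAs (Fintype (Option (p.Lab ⊕ q.Lab)))
  | .drain _ _ _ p => letI := p.fintypeLab; inferInstanceAs (Fintype (Option p.Lab))

/-- The first label of a compiled program. -/
def Prog.entry : (p : Prog Γ σ) → p.Lab
  | .load _ => ()
  | .act _ _ _ _ => ()
  | .seq p _ => Sum.inl p.entry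
  | .ite _ _ _ => none
  | .drain _ _ _ _ => none

/-- The internal states of a compiled program: for every stack, the letter popped last is kept. -/
abbrev Reg (Γ : K → Type) (σ : Type) : Type := σ × (∀ k, Option (Γ k))

variable [∀ k, Inhabited (Γ k)] {Λ : Type}

/-- The statement for an `Emit`, followed by `q`. -/
def Emit.code (k : K) (q : TM2.Stmt Γ Λ (Reg Γ σ)) : Emit Γ σ (Γ k) → TM2.Stmt Γ Λ (Reg Γ σ)
  | .nil => q
  | .push k' f e => .push k' (fun v => (v.2 k).elim default (f v.1)) (e.code k q)
  | .br c e₁ e₂ => .branch (fun v => (v.2 k).elim false (c v.1)) (e₁.code k q) (e₂.code k q)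

/-- Pop a letter from `k`, and continue with `q₁` if there was one and with `q₀` otherwise. -/
def popCode (k : K) (g : σ → Γ k → σ) (e : Emit Γ σ (Γ k)) (q₀ q₁ : TM2.Stmt Γ Λ (Reg Γ σ)) :
    TM2.Stmt Γ Λ (Reg Γ σ) :=
  .pop k (fun v o => (v.1, update v.2 k o)) <| .branch (fun v => (v.2 k).isSome)
    (e.code k (.load (fun v => ((v.2 k).elim v.1 (g v.1), v.2)) q₁)) q₀

/-- The statements of a compiled program, whose labels are embedded by `emb`, and which continues at
the label `ex`. -/
def Prog.code : (p : Prog Γ σ) → (p.Lab → Λ) → Λ → p.Lab → TM2.Stmt Γ Λ (Reg Γ σ)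
  | .load g, _, ex, _ => .load (fun v => (g v.1, v.2)) (.goto fun _ => ex)
  | .act k g₀ g e, _, ex, _ =>
    popCode k g e (.load (fun v => (g₀ v.1, v.2)) (.goto fun _ => ex)) (.goto fun _ => ex)
  | .seq p q, emb, _, .inl l => p.code (fun l => emb (.inl l)) (emb (.inr q.entry)) l
  | .seq _ q, emb, ex, .inr l => q.code (fun l => emb (.inr l)) ex l
  | .ite c p q, emb, _, none =>
    .branch (fun v => c v.1) (.goto fun _ => emb (some (.inl p.entry)))
      (.goto fun _ => emb (some (.inr q.entry)))
  | .ite _ p _, emb, ex, some (.inl l) => p.code (fun l => emb (some (.inl l))) ex l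
  | .ite _ _ q, emb, ex, some (.inr l) => q.code (fun l => emb (some (.inr l))) ex l
  | .drain k g e p, emb, ex, none =>
    popCode k g e (.goto fun _ => ex) (.goto fun _ => emb (some p.entry))
  | .drain _ _ _ p, emb, _, some l => p.code (fun l => emb (some l)) (emb none) l

/-- A machine's `push` and `branch` see only the internal state. They can use the popped letter
because the register of `k` still holds it. -/
theorem Emit.stepAux_code {k : K} (q : TM2.Stmt Γ Λ (Reg Γ σ)) (e : Emit Γ σ (Γ k)) (v : Reg Γ σ)
    (a : Γ k) (h : v.2 k = some a) (S : ∀ k, List (Γ k)) :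
    TM2.stepAux (e.code k q) v S = TM2.stepAux q v (e.run v.1 a S) := by
  induction e generalizing S with
  | nil => rfl
  | push k' f e ih => simp [code, run, ih, h]
  | br c e₁ e₂ ih₁ ih₂ => cases hc : c v.1 a <;> simp [code, run, ih₁, ih₂, h, hc]

theorem stepAux_popCode_nil {k : K} (g : σ → Γ k → σ) (e : Emit Γ σ (Γ k))
    (q₀ q₁ : TM2.Stmt Γ Λ (Reg Γ σ)) (v : Reg Γ σ) (S : ∀ k, List (Γ k)) (h : S k = []) :
    TM2.stepAux (popCode k g e q₀ q₁) v S = TM2.stepAux q₀ (v.1, update v.2 k none) S := by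
  have : update S k [] = S := by rw [← h, update_eq_self]
  simp [popCode, h, this]

theorem stepAux_popCode_cons {k : K} (g : σ → Γ k → σ) (e : Emit Γ σ (Γ k))
    (q₀ q₁ : TM2.Stmt Γ Λ (Reg Γ σ)) (v : Reg Γ σ) (S : ∀ k, List (Γ k)) (a : Γ k) (l : List (Γ k))
    (h : S k = a :: l) :
    TM2.stepAux (popCode k g e q₀ q₁) v S =
      TM2.stepAux q₁ (g v.1 a, update v.2 k (some a)) (e.run v.1 a (update S k l)) := by
  simp only [popCode, h, TM2.stepAux, List.head?_cons, List.tail_cons, update_self,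
    Option.isSome_some, cond_true]
  rw [Emit.stepAux_code _ _ _ a (by simp)]
  simp

/-- The machine `M` gets from `c` to `c'` in `t` steps. -/
def Steps (M : Λ → TM2.Stmt Γ Λ σ) (t : ℕ) (c c' : TM2.Cfg Γ Λ σ) : Prop :=
  (flip bind (TM2.step M))^[t] (some c) = some c'

omit [∀ k, Inhabited (Γ k)] in
theorem Steps.trans {M : Λ → TM2.Stmt Γ Λ σ} {t₁ t₂ : ℕ} {c₁ c₂ c₃ : TM2.Cfg Γ Λ σ}
    (h₁ : Steps M t₁ c₁ c₂) (h₂ : Steps M t₂ c₂ c₃) : Steps M (t₁ + t₂) c₁ c₃ := by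
  unfold Steps at *
  rw [Nat.add_comm, iterate_add_apply, h₁, h₂]

omit [∀ k, Inhabited (Γ k)] in
theorem Steps.single {M : Λ → TM2.Stmt Γ Λ σ} {c c' : TM2.Cfg Γ Λ σ} (h : TM2.step M c = some c') :
    Steps M 1 c c' := h

open Polynomial in
/-- A bound for the running time of a program, in terms of the weight of the memory. -/
noncomputable def Prog.time : Prog Γ σ → Polynomial ℕ
  | .load _ => 1
  | .act _ _ _ _ => 1
  | .seq p q => p.time + q.time
  | .ite _ p q => 1 + p.time + q.time
  | .drain _ _ _ p => X * (1 + p.time) + 1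

/-- All weights are at least 1, so no stack is higher than the total weight and a loop makes at most
`n` passes. The weight does not grow, so the body's bound at `n` is valid in every pass. The
registers may be arbitrary: each is overwritten by a pop before it is read. -/
theorem Prog.steps_code [Fintype K] (w : K → ℕ) (hw : ∀ k, 1 ≤ w k)
    {M : Λ → TM2.Stmt Γ Λ (Reg Γ σ)} (p : Prog Γ σ) (hp : p.wf w = true) (emb : p.Lab → Λ) (ex : Λ)
    (hM : ∀ l, M (emb l) = p.code emb ex l) (n : ℕ) (s : σ × (∀ k, List (Γ k)))
    (hs : weight w s.2 ≤ n) (r : ∀ k, Option (Γ k)) :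
    ∃ t ≤ p.time.eval n, ∃ r', Steps M t ⟨some (emb p.entry), (s.1, r), s.2⟩
      ⟨some ex, ((p.den s).1, r'), (p.den s).2⟩ := by
  induction p generalizing ex s r with
  | load g =>
    refine ⟨1, by simp [time], r, Steps.single ?_⟩
    simp [hM, code, den]
  | act k g₀ g e =>
    refine ⟨1, by simp [time], ?_⟩
    cases hk : s.2 k with
    | nil =>
      refine ⟨update r k none, Steps.single ?_⟩
      simp [hM, code, den, hk, stepAux_popCode_nil]
    | cons a l =>
      refine ⟨update r k (some a), Steps.single ?_⟩
      simp [hM, code, den, hk, stepAux_popCode_cons _ _ _ _ _ _ _ _ hk]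
  | seq p q ihp ihq =>
    simp only [wf, Bool.and_eq_true] at hp
    obtain ⟨t₁, ht₁, r₁, h₁⟩ :=
      ihp hp.1 (fun l => emb (.inl l)) (emb (.inr q.entry)) (fun l => hM (.inl l)) s hs r
    obtain ⟨t₂, ht₂, r₂, h₂⟩ :=
      ihq hp.2 (fun l => emb (.inr l)) ex (fun l => hM (.inr l)) (p.den s)
        ((p.weight_den_le w hp.1 s).trans hs) r₁
    exact ⟨t₁ + t₂, by simpa [time] using Nat.add_le_add ht₁ ht₂, r₂, h₁.trans h₂⟩
  | ite c p q ihp ihq =>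
    simp only [wf, Bool.and_eq_true] at hp
    cases hc : c s.1 with
    | true =>
      obtain ⟨t, ht, r', h⟩ :=
        ihp hp.1 (fun l => emb (some (.inl l))) ex (fun l => hM (some (.inl l))) s hs r
      refine ⟨1 + t, ?_, r', ?_⟩
      · simp only [time, Polynomial.eval_add, Polynomial.eval_one]; omega
      · rw [show (Prog.ite c p q).den s = p.den s by simp [den, hc]]
        refine Steps.trans (Steps.single ?_) h
        have hM₀ := hM none
        simp only [code] at hM₀
        simp [entry, hM₀, hc]
    | false =>
      obtain ⟨t, ht, r', h⟩ :=
        ihq hp.2 (fun l => emb (some (.inr l))) ex (fun l => hM (some (.inr l))) s hs r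
      refine ⟨1 + t, ?_, r', ?_⟩
      · simp only [time, Polynomial.eval_add, Polynomial.eval_one]; omega
      · rw [show (Prog.ite c p q).den s = q.den s by simp [den, hc]]
        refine Steps.trans (Steps.single ?_) h
        have hM₀ := hM none
        simp only [code] at hM₀
        simp [entry, hM₀, hc]
  | drain k g e p ih =>
    simp only [wf, Bool.and_eq_true, decide_eq_true_eq] at hp
    suffices H : ∃ t ≤ n * (1 + p.time.eval n) + 1, ∃ r',
        Steps M t ⟨some (emb none), (s.1, r), s.2⟩
          ⟨some ex, (((Prog.drain k g e p).den s).1, r'), ((Prog.drain k g e p).den s).2⟩ by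
      simpa [time, entry] using H
    have hM₀ := hM none
    simp only [code] at hM₀
    have hlen := (length_le_weight w hw s.2 k).trans hs
    -- Only the number `m` of remaining passes decreases; the cost of a pass stays bounded at the
    -- fixed `n`. The final `+ 1` pays for the pop that finds the stack empty.
    refine Prog.drain_induction k g e p hp.1.1.2 hp.1.2
      (P := fun m s => weight w s.2 ≤ n → ∀ r, ∃ t ≤ m * (1 + p.time.eval n) + 1, ∃ r',
        Steps M t ⟨some (emb none), (s.1, r), s.2⟩
          ⟨some ex, (((Prog.drain k g e p).den s).1, r'), ((Prog.drain k g e p).den s).2⟩)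
      ?_ ?_ n s hlen hs r
    · intro m s hk _ r
      refine ⟨1, by omega, update r k none, Steps.single ?_⟩
      rw [den_drain_nil k g e p s.1 s.2 hk]
      simp [hM₀, stepAux_popCode_nil, hk]
    · intro m s a l hk IH hs r
      have hs' := (Emit.weight_run_update_le w s.1 a l e hp.1.1.1 s.2 hk).trans hs
      obtain ⟨t₁, ht₁, r₁, h₁⟩ := ih hp.2 (fun l => emb (some l)) (emb none) (fun l => hM (some l))
        (g s.1 a, e.run s.1 a (update s.2 k l)) hs' (update r k (some a))
      obtain ⟨t₂, ht₂, r₂, h₂⟩ := IH ((p.weight_den_le w hp.2 _).trans hs') r₁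
      refine ⟨1 + t₁ + t₂, ?_, r₂, ?_⟩
      · have : (m + 1) * (1 + p.time.eval n) = m * (1 + p.time.eval n) + (1 + p.time.eval n) := by
          ring
        omega
      · rw [← Prog.den_drain_cons k g e p hp.1.1.2 hp.1.2 s.1 s.2 a l hk] at h₂
        refine Steps.trans (Steps.trans (Steps.single ?_) h₁) h₂
        simp [hM₀, stepAux_popCode_cons _ _ _ _ _ _ _ _ hk]

/-- The stacks when only `k` is nonempty. -/
def single (k : K) (l : List (Γ k)) : ∀ k, List (Γ k) := update (fun _ => []) k l

omit [∀ k, Inhabited (Γ k)] in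
theorem weight_single [Fintype K] (w : K → ℕ) (k : K) (l : List (Γ k)) :
    weight w (single k l) = w k * l.length := by
  have := weight_update w (fun k => ([] : List (Γ k))) k l
  have h0 : weight w (fun k => ([] : List (Γ k))) = 0 := by simp [weight]
  rw [h0] at this
  simpa [single] using this

omit [∀ k, Inhabited (Γ k)] in
-- `initList` and `haltList` define their stacks by such a case distinction with a cast.
theorem dite_eq_single (j : K) (l : List (Γ j)) (k : K) (h : k = j → List (Γ k) = List (Γ j)) :
    (if hk : k = j then (h hk).mpr l else []) = single j l k := by
  by_cases hk : k = j
  · subst hk; simp [single]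
  · simp [single, hk]

/-- The Turing machine that runs a program and then writes its result. -/
def machine [Fintype K] [Fintype σ] [∀ k, Fintype (Γ k)] (inp out : K) (p : Prog Γ σ) (v₀ : σ)
    (res : σ → Γ out) : FinTM2 where
  K := K
  k₀ := inp
  k₁ := out
  Γ := Γ
  Λ := Option p.Lab
  main := some p.entry
  σ := Reg Γ σ
  initialState := (v₀, fun _ => none)
  m := fun l => match l with
    | some l => p.code some none l
    | none => .push out (fun v => res v.1) (.load (fun _ => (v₀, fun _ => none)) .halt)

/-- A function that is computed by a well-formed stack program, which leaves all its stacks empty,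
is computed by a Turing machine in polynomial time. -/
theorem computableInPolyTime [Fintype K] [Fintype σ] [∀ k, Fintype (Γ k)] (inp out : K)
    (p : Prog Γ σ) (w : K → ℕ) (hw : ∀ k, 1 ≤ w k) (hp : p.wf w = true) (v₀ : σ)
    (res : σ → Γ out) {α β Γ₀ Γ₁ : Type} (i : Γ inp ≃ Γ₀) (o : Γ out ≃ Γ₁)
    (ea : α → List Γ₀) (eb : β → List Γ₁) (f : α → β)
    (h : ∀ a, ((p.den (v₀, single inp ((ea a).map i.symm))).2 = fun _ => []) ∧
      [o (res (p.den (v₀, single inp ((ea a).map i.symm))).1)] = eb (f a)) :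
    Nonempty (TM2ComputableInPolyTime ea eb f) := by
  -- An input of length `X` has weight `w inp * X`. The additional step pushes the result, resets
  -- the internal state and halts.
  refine ⟨⟨⟨machine inp out p v₀ res, i, o⟩, p.time.comp (Polynomial.C (w inp) * Polynomial.X) + 1,
    fun a => ?_⟩⟩
  obtain ⟨h₁, h₂⟩ := h a
  set S : ∀ k, List (Γ k) := single inp ((ea a).map i.symm) with hS
  have hweight : weight w S ≤ w inp * (ea a).length := by
    rw [hS, weight_single, List.length_map]
  have hM : ∀ l : p.Lab, (machine inp out p v₀ res).m (some l) = p.code some none l := fun l => rfl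
  have H := Prog.steps_code w hw p hp (some : p.Lab → Option p.Lab) none hM _ (v₀, S) hweight
    (fun _ => none)
  -- The goal is data rather than a proposition, so the existentials are opened by choice and the
  -- chosen values generalized.
  have ht := H.choose_spec.1
  have hr := H.choose_spec.2.choose_spec
  generalize H.choose_spec.2.choose = r' at hr
  generalize H.choose = t at ht hr
  refine ⟨⟨t + 1, ?_⟩, ?_⟩
  · have hinit : initList (machine inp out p v₀ res) ((ea a).map i.invFun) =
        ⟨some (some p.entry), (v₀, fun _ => none), S⟩ :=
      congrArg (TM2.Cfg.mk (some (some p.entry)) (v₀, fun _ => none))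
        (funext fun k => dite_eq_single inp _ k _)
    have hout : (eb (f a)).map o.symm = [res (p.den (v₀, S)).1] := by simp [← h₂]
    have hhalt : haltList (machine inp out p v₀ res) ((eb (f a)).map o.invFun) =
        ⟨none, (v₀, fun _ => none), single out [res (p.den (v₀, S)).1]⟩ :=
      (congrArg (TM2.Cfg.mk none (v₀, fun _ => none))
        (funext fun k => dite_eq_single out _ k _)).trans
        (congrArg (fun l => TM2.Cfg.mk none (v₀, fun _ => none) (single out l)) hout)
    have hlast : Steps (machine inp out p v₀ res).m 1
        ⟨some none, ((p.den (v₀, S)).1, r'), (p.den (v₀, S)).2⟩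
        (haltList (machine inp out p v₀ res) ((eb (f a)).map o.invFun)) := by
      -- The halting configuration prescribes the initial internal state and only the output on the
      -- stacks. This is why the last statement resets the state and why the program must leave
      -- every stack empty.
      rw [hhalt, h₁]
      exact Steps.single rfl
    rw [hinit]
    exact Steps.trans hr hlast
  · simpa using ht

end StackProg

/-! ### A stack program for the constraint satisfaction problem -/

namespace SemilatticeCSP

open StackProg Function

/-! ### Marks, letters, stacks and internal variables -/

/-- A mark says, for each of two runs of the closure, whether a variable has been derived. -/
abbrev Mark : Type := Bool → Bool

/-- The kinds of constraints: an equation, or a disequality that is still to be checked, that is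
currently checked, or that has been checked. -/
inductive Kind : Type
  | eq | todo | cur | done
  deriving DecidableEq

instance : Fintype Kind := ⟨{.eq, .todo, .cur, .done}, fun k => by cases k <;> decide⟩

/-- The letters on the work stacks. -/
inductive Sym : Type
  | bit (b : Bool)
  | occ (side : Bool) (m : Mark)
  | head (k : Kind) (fire : Mark)
  deriving DecidableEq, Fintype

/-- The work stacks. -/
inductive Work : Type
  | R | L | V | W | X | Y | Z | N | C | D | E
  deriving DecidableEq

instance : Fintype Work :=
  ⟨{.R, .L, .V, .W, .X, .Y, .Z, .N, .C, .D, .E}, fun k => by cases k <;> decide⟩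

/-- All stacks. -/
inductive Stk : Type
  | inp | out
  | wk (i : Work)
  deriving DecidableEq, Fintype

/-- The letters on each stack. -/
@[reducible] def Cell : Stk → Type
  | .inp => Letter
  | .out => Bool
  | .wk _ => Sym

instance : ∀ k, Fintype (Cell k)
  | .inp => inferInstanceAs (Fintype Letter)
  | .out => inferInstanceAs (Fintype Bool)
  | .wk _ => inferInstanceAs (Fintype Sym)

instance : ∀ k, Inhabited (Cell k)
  | .inp => ⟨Letter.meet⟩
  | .out => ⟨false⟩
  | .wk _ => ⟨Sym.bit false⟩

/-- Internal variables that are only used while a name is compared with another one. -/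
structure Scratch : Type where
  isOcc : Bool := false
  cmp : Bool := false
  neq : Bool := false
  vm : Mark := ⊥
  deriving Fintype

/-- The internal variables of the program. -/
structure Var : Type where
  bad : Bool := false
  sel : Bool := false
  cur : Bool := false
  side : Bool := false
  mark : Mark := ⊥
  fire : Mark := ⊥
  conj : Bool → Mark := ⊤
  scr : Scratch := {}

noncomputable instance : Fintype Var :=
  Fintype.ofInjective
    (fun v : Var => (v.bad, v.sel, v.cur, v.side, v.mark, v.fire, v.conj, v.scr))
    (by rintro ⟨⟩ ⟨⟩ h; simpa using h)

/-- The contents of the stacks, except for the output. -/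
structure Mem : Type where
  inp : List Letter := []
  R : List Sym := []
  L : List Sym := []
  V : List Sym := []
  W : List Sym := []
  X : List Sym := []
  Y : List Sym := []
  Z : List Sym := []
  N : List Sym := []
  C : List Sym := []
  D : List Sym := []
  E : List Sym := []

/-- The stacks given by their contents. -/
def Mem.fn (m : Mem) : ∀ k, List (Cell k)
  | .inp => m.inp
  | .out => []
  | .wk .R => m.R
  | .wk .L => m.L
  | .wk .V => m.V
  | .wk .W => m.W
  | .wk .X => m.X
  | .wk .Y => m.Y
  | .wk .Z => m.Z
  | .wk .N => m.N
  | .wk .C => m.C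
  | .wk .D => m.D
  | .wk .E => m.E

section Update

variable (m : Mem) (l : List Sym)

@[simp] theorem update_inp (l : List Letter) : update m.fn .inp l = { m with inp := l }.fn := by
  funext k; rcases k with _ | _ | i <;> [rfl; rfl; (cases i <;> rfl)]
@[simp] theorem update_R : update m.fn (.wk .R) l = { m with R := l }.fn := by
  funext k; rcases k with _ | _ | i <;> [rfl; rfl; (cases i <;> rfl)]
@[simp] theorem update_L : update m.fn (.wk .L) l = { m with L := l }.fn := by
  funext k; rcases k with _ | _ | i <;> [rfl; rfl; (cases i <;> rfl)]
@[simp] theorem update_V : update m.fn (.wk .V) l = { m with V := l }.fn := by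
  funext k; rcases k with _ | _ | i <;> [rfl; rfl; (cases i <;> rfl)]
@[simp] theorem update_W : update m.fn (.wk .W) l = { m with W := l }.fn := by
  funext k; rcases k with _ | _ | i <;> [rfl; rfl; (cases i <;> rfl)]
@[simp] theorem update_X : update m.fn (.wk .X) l = { m with X := l }.fn := by
  funext k; rcases k with _ | _ | i <;> [rfl; rfl; (cases i <;> rfl)]
@[simp] theorem update_Y : update m.fn (.wk .Y) l = { m with Y := l }.fn := by
  funext k; rcases k with _ | _ | i <;> [rfl; rfl; (cases i <;> rfl)]
@[simp] theorem update_Z : update m.fn (.wk .Z) l = { m with Z := l }.fn := by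
  funext k; rcases k with _ | _ | i <;> [rfl; rfl; (cases i <;> rfl)]
@[simp] theorem update_N : update m.fn (.wk .N) l = { m with N := l }.fn := by
  funext k; rcases k with _ | _ | i <;> [rfl; rfl; (cases i <;> rfl)]
@[simp] theorem update_C : update m.fn (.wk .C) l = { m with C := l }.fn := by
  funext k; rcases k with _ | _ | i <;> [rfl; rfl; (cases i <;> rfl)]
@[simp] theorem update_D : update m.fn (.wk .D) l = { m with D := l }.fn := by
  funext k; rcases k with _ | _ | i <;> [rfl; rfl; (cases i <;> rfl)]
@[simp] theorem update_E : update m.fn (.wk .E) l = { m with E := l }.fn := by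
  funext k; rcases k with _ | _ | i <;> [rfl; rfl; (cases i <;> rfl)]

@[simp] theorem fn_inp : m.fn .inp = m.inp := rfl
@[simp] theorem fn_R : m.fn (.wk .R) = m.R := rfl
@[simp] theorem fn_L : m.fn (.wk .L) = m.L := rfl
@[simp] theorem fn_V : m.fn (.wk .V) = m.V := rfl
@[simp] theorem fn_W : m.fn (.wk .W) = m.W := rfl
@[simp] theorem fn_X : m.fn (.wk .X) = m.X := rfl
@[simp] theorem fn_Y : m.fn (.wk .Y) = m.Y := rfl
@[simp] theorem fn_Z : m.fn (.wk .Z) = m.Z := rfl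
@[simp] theorem fn_N : m.fn (.wk .N) = m.N := rfl
@[simp] theorem fn_C : m.fn (.wk .C) = m.C := rfl
@[simp] theorem fn_D : m.fn (.wk .D) = m.D := rfl
@[simp] theorem fn_E : m.fn (.wk .E) = m.E := rfl

end Update

abbrev Code : Type := Prog Cell Var

/-! ### Moving and emptying stacks -/

/-- Do nothing. -/
def skip : Code := .load id

/-- Move the stack `i` to the stack `j`, translating its letters. -/
def pass (i j : Work) (g : Var → Sym → Var) (f : Var → Sym → Sym) : Code :=
  .drain (.wk i) g (.push (.wk j) f .nil) skip

/-- Move the stack `i` to the stack `j`, in reverse order. -/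
def move (i j : Work) : Code := pass i j (fun v _ => v) (fun _ a => a)

/-- Empty the stack `i`. -/
def clear (i : Work) : Code := .drain (.wk i) (fun v _ => v) .nil skip

/-- What `pass` computes. -/
def passFold (g : Var → Sym → Var) (f : Var → Sym → Sym) :
    List Sym → Var → List Sym → Var × List Sym
  | [], v, acc => (v, acc)
  | a :: l, v, acc => passFold g f l (g v a) (f v a :: acc)

theorem den_pass {i j : Work} (hij : i ≠ j) (g : Var → Sym → Var) (f : Var → Sym → Sym) (v : Var)
    (S : ∀ k, List (Cell k)) :
    (pass i j g f).den (v, S) = ((passFold g f (S (.wk i)) v (S (.wk j))).1,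
      update (update S (.wk j) (passFold g f (S (.wk i)) v (S (.wk j))).2) (.wk i) []) := by
  have hne : (Stk.wk i) ≠ .wk j := by simpa using hij
  generalize hl : S (.wk i) = l
  induction l generalizing v S with
  | nil =>
    rw [pass, Prog.den_drain_nil _ _ _ _ _ _ hl]
    simp only [passFold, update_eq_self]
    rw [← hl, update_eq_self]
  | cons a l ih =>
    rw [pass, Prog.den_drain_cons _ _ _ _ (by simp [Emit.avoids, hij]) rfl _ _ a l hl, ← pass]
    simp only [Emit.run, skip, Prog.den, id]
    rw [ih _ _ (by rw [update_of_ne hne, update_self])]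
    simp only [passFold, update_self, update_of_ne hne.symm]
    congr 1
    funext k
    by_cases h₁ : k = .wk i
    · subst h₁; simp
    · by_cases h₂ : k = .wk j
      · subst h₂; simp [hij.symm]
      · simp [h₁, h₂]

theorem passFold_const (f : Sym → Sym) (l : List Sym) (v : Var) (acc : List Sym) :
    passFold (fun v _ => v) (fun _ a => f a) l v acc = (v, (l.map f).reverse ++ acc) := by
  induction l generalizing acc with
  | nil => rfl
  | cons a l ih => simp [passFold, ih]

theorem den_move {i j : Work} (hij : i ≠ j) (v : Var) (S : ∀ k, List (Cell k)) :
    (move i j).den (v, S) =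
      (v, update (update S (.wk j) (List.reverse (α := Sym) (S (.wk i)) ++ S (.wk j))) (.wk i) []) := by
  rw [move, den_pass hij, passFold_const (fun a => a)]
  simp

theorem den_clear (i : Work) (v : Var) (S : ∀ k, List (Cell k)) :
    (clear i).den (v, S) = (v, update S (.wk i) []) := by
  generalize hl : S (.wk i) = l
  induction l generalizing v S with
  | nil =>
    rw [clear, Prog.den_drain_nil _ _ _ _ _ _ hl, ← hl, update_eq_self]
  | cons a l ih =>
    rw [clear, Prog.den_drain_cons _ _ _ _ rfl rfl _ _ a l hl, ← clear]
    simp only [Emit.run, skip, Prog.den, id]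
    rw [ih _ _ (by rw [update_self])]
    simp

/-! #### The program -/

/-- Compare the letter popped last from `V` with the name on `Y`. -/
def scanBody : Code :=
  .ite (fun v => v.scr.isOcc)
    (.seq (.act (.wk .Y) id (fun v _ => { v with scr.neq := true }) (.push (.wk .X) (fun _ a => a) .nil))
    (.seq (.ite (fun v => v.scr.neq) skip
      (.seq (.load fun v => { v with mark := v.mark ⊔ v.scr.vm })
        (.act (.wk .W) id (fun v _ => v) (.push (.wk .W) (fun v _ => Sym.occ false v.mark) .nil))))
    (.seq (move .X .Y) (.load fun v => { v with scr := {} }))))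
    (.act (.wk .Y) (fun v => { v with scr.neq := true })
      (fun v a => { v with scr.neq := v.scr.neq || !decide (a = Sym.bit v.scr.cmp) })
      (.push (.wk .X) (fun _ a => a) .nil))

/-- The change of the internal variables when a letter is popped from `V`. -/
def scanVar (v : Var) : Sym → Var
  | .bit b => { v with scr.isOcc := false, scr.cmp := b }
  | .occ _ m => { v with scr.isOcc := true, scr.vm := m }
  | .head _ _ => v

/-- Search the name on `Y` in the table on `V`, adding the mark `v.mark` to its entries there, and
adding their marks to `v.mark`. The table is moved to `W`. -/
def scan : Code := .drain (.wk .V) scanVar (.push (.wk .W) (fun _ a => a) .nil) scanBody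

/-- Search the name on `X` in the table on `V`, and move it to `L`. -/
def lookup : Code :=
  .seq (move .X .Y) (.seq scan (.seq (move .W .V) (move .Y .L)))

/-- The change of the internal variables when `collect` pops a letter. -/
def collectVar (v : Var) : Sym → Var
  | .bit _ => { v with scr.isOcc := false }
  | .occ s m => { v with scr.isOcc := true, side := s, mark := m }
  | .head k _ => { v with
      bad := v.bad || (decide (k = .cur) && decide (v.conj false ⊓ v.conj true = ⊤))
      conj := ⊤ }

/-- The letter that `collect` pushes for the head of a constraint. -/
def collectHead (v : Var) : Sym → Sym
  | .head k _ => .head k (if k = .eq then v.conj false ⊔ v.conj true else ⊥)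
  | a => a

/-- Is this the head of a constraint? -/
def Sym.isHead : Sym → Bool
  | .head _ _ => true
  | _ => false

/-- Is this a bit? -/
def Sym.isBit : Sym → Bool
  | .bit _ => true
  | _ => false

/-- Move the formula from `R` to `L`, synchronizing its marks with those in the table, and noting for
each equation whether one of its sides is derived. -/
def collect : Code :=
  .drain (.wk .R) collectVar
    (.br (fun _ a => Sym.isBit a) (.push (.wk .X) (fun _ a => a) .nil)
      (.br (fun _ a => Sym.isHead a) (.push (.wk .L) collectHead .nil)
        (.push (.wk .Z) (fun _ a => a) .nil)))
    (.ite (fun v => v.scr.isOcc)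
      (.seq (.load fun v => { v with scr := {} })
      (.seq lookup
        (.act (.wk .Z) id
          (fun v _ => { v with
            conj := update v.conj v.side (v.conj v.side ⊓ v.mark), side := false, mark := ⊥ })
          (.push (.wk .L) (fun v _ => Sym.occ v.side v.mark) .nil))))
      skip)

/-- The change of the internal variables when `spread` pops a letter. -/
def spreadVar (v : Var) : Sym → Var
  | .head _ fr => { v with fire := fr }
  | _ => v

/-- The letter that `spread` pushes. -/
def spreadSym (v : Var) : Sym → Sym
  | .head k _ => .head k ⊥
  | .occ s m => .occ s (m ⊔ v.fire)
  | .bit b => .bit b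

/-- One round of the closure. -/
def round : Code :=
  .seq collect (.seq (pass .L .R spreadVar spreadSym) (.load fun v => { v with fire := ⊥ }))

/-- The change of the internal variables when `select` pops a letter. -/
def selectVar (v : Var) : Sym → Var
  | .head .todo _ => { v with sel := true, cur := !v.sel }
  | .head _ _ => { v with cur := false }
  | _ => v

/-- The letter that `select` pushes. -/
def selectSym (v : Var) : Sym → Sym
  | .head .todo _ => .head (if v.sel then .todo else .cur) ⊥
  | .head .cur _ => .head .done ⊥
  | .head k _ => .head k ⊥
  | .occ s _ => .occ s (if v.cur then fun d => decide (d = s) else ⊥)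
  | .bit b => .bit b

/-- Remove the marks of an entry of the table. -/
def resetSym : Sym → Sym
  | .occ s _ => .occ s ⊥
  | a => a

/-- Choose the next disequality, and remove all marks except those that start its closure. -/
def select : Code :=
  .seq (move .R .L)
  (.seq (pass .L .R selectVar selectSym)
  (.seq (.load fun v => { v with sel := false, cur := false })
  (.seq (pass .V .W (fun v _ => v) (fun _ a => resetSym a)) (move .W .V))))

/-- Repeat `round` as often as there are letters on `C`. -/
def saturate : Code :=
  .seq (.drain (.wk .C) (fun v _ => v) (.push (.wk .D) (fun _ a => a) .nil) round) (move .D .C)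

/-- The change of the internal variables when a letter of the input is popped. -/
def parseVar (v : Var) : Letter → Var
  | .eq => { v with side := false, scr.isOcc := false }
  | .ne => { v with side := false, scr.isOcc := false }
  | .var => { v with scr.isOcc := true }
  | _ => { v with scr.isOcc := false }

/-- The translation of a letter of the input. -/
def parseSym (v : Var) : Letter → Sym
  | .eq => .head .eq ⊥
  | .ne => .head .todo ⊥
  | .var => .occ v.side ⊥
  | .meet => .bit false
  | .bit b => .bit b

/-- The translation of a letter of the input for the table of names. -/
def parseName : Letter → Sym
  | .bit b => .bit b
  | _ => .occ false ⊥

/-- Is this the symbol of the operation? -/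
def Letter.isMeet : Letter → Bool
  | .meet => true
  | _ => false

/-- Is this letter part of a variable? -/
def Letter.inVar : Letter → Bool
  | .var => true
  | .bit _ => true
  | _ => false

/-- Read the input: write the formula to `R`, the table of names to `V`, and counters to `C` and
`E`. -/
def parse : Code :=
  .drain .inp parseVar
    (.push (.wk .E) (fun _ _ => Sym.bit false)
    (.push (.wk .C) (fun _ _ => Sym.bit false)
    (.push (.wk .C) (fun _ _ => Sym.bit false)
    (.push (.wk .C) (fun _ _ => Sym.bit false)
    (.push (.wk .C) (fun _ _ => Sym.bit false)
    (.br (fun _ a => Letter.isMeet a) (.push (.wk .N) (fun _ _ => Sym.bit false) .nil)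
      (.push (.wk .R) parseSym
        (.br (fun _ a => Letter.inVar a) (.push (.wk .V) (fun _ a => parseName a) .nil) .nil))))))))
    (.ite (fun v => v.scr.isOcc)
      (.seq (.act (.wk .N) (fun v => { v with side := true }) (fun v _ => v) .nil)
        (.load fun v => { v with scr := {} }))
      skip)

/-- Check all disequalities. -/
def check : Code := .drain (.wk .E) (fun v _ => v) .nil (.seq select saturate)

/-- The whole program. -/
def solve : Code :=
  .seq parse (.seq (.load fun _ => {}) (.seq check (.seq (clear .R) (.seq (clear .V) (clear .C)))))

/-- The weights of the stacks. -/
def wt : Stk → ℕ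
  | .inp => 8
  | _ => 1

/-- Only `parse` pushes more than one letter per pop: five counter letters and at most two more, for
the formula and the table. Weight 8 on the input covers these seven. -/
theorem wf_solve : solve.wf wt = true := by decide

end SemilatticeCSP

namespace SemilatticeCSP

open StackProg Function

/-! #### The effect of the program on formulas -/

/-- Names of variables. -/
abbrev Name : Type := List Bool

/-- An occurrence of a variable on one side of a constraint. -/
structure Tok : Type where
  side : Bool
  name : Name
  mark : Mark

/-- A constraint between two meets of variables. -/
structure Con : Type where
  kind : Kind
  fire : Mark
  toks : List Tok

/-- These words lie reversed on `R`, and the table lies reversed on `V`. So `collect` meets a name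
before its mark, and the head of a constraint after all its occurrences, when their conjunction is
known. The pass back from `L` reads forwards, meets the head first, and can hand the fired marks to
the occurrences. -/
def encTok (t : Tok) : List Sym := .occ t.side t.mark :: t.name.map .bit

def encCon (c : Con) : List Sym := .head c.kind c.fire :: c.toks.flatMap encTok

def encForm (F : List Con) : List Sym := F.flatMap encCon

/-- The table of the names `T`, with marks `μ`. -/
def encTable (T : List Name) (μ : Name → Mark) : List Sym :=
  T.flatMap fun x => .occ false (μ x) :: x.map .bit

/-- Synchronize the marks of a list of occurrences with those in the table. -/
def syncToks : List Tok → (Name → Mark) → List Tok × (Name → Mark)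
  | [], μ => ([], μ)
  | t :: ts, μ =>
    ({ t with mark := t.mark ⊔ (syncToks ts μ).2 t.name } :: (syncToks ts μ).1,
      update (syncToks ts μ).2 t.name (t.mark ⊔ (syncToks ts μ).2 t.name))

/-- The marks that all occurrences on a given side have. -/
def conjOf : List Tok → Bool → Mark
  | [] => ⊤
  | t :: ts => update (conjOf ts) t.side (conjOf ts t.side ⊓ t.mark)

/-- The result of `collect` on a constraint. -/
def collectCon (c : Con) (ts : List Tok) : Con :=
  ⟨c.kind, if c.kind = .eq then conjOf ts false ⊔ conjOf ts true else ⊥, ts⟩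

/-- The result of `collect` on a formula. -/
def collectForm : List Con → (Name → Mark) → List Con × (Name → Mark)
  | [], μ => ([], μ)
  | c :: F, μ =>
    (collectCon c (syncToks c.toks (collectForm F μ).2).1 :: (collectForm F μ).1,
      (syncToks c.toks (collectForm F μ).2).2)

/-- In the current constraint, everything has been derived. -/
def Con.bad (c : Con) : Bool :=
  decide (c.kind = .cur) && decide (conjOf c.toks false ⊓ conjOf c.toks true = ⊤)

/-- Mark all occurrences in a constraint with its fired marks. -/
def spreadCon (c : Con) : Con :=
  ⟨c.kind, ⊥, c.toks.map fun t => { t with mark := t.mark ⊔ c.fire }⟩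

/-- One round of the closure. -/
def roundForm (s : List Con × (Name → Mark) × Bool) : List Con × (Name → Mark) × Bool :=
  ((collectForm s.1 s.2.1).1.map spreadCon, (collectForm s.1 s.2.1).2,
    s.2.2 || (collectForm s.1 s.2.1).1.any Con.bad)

/-- The occurrences on side `s` start the closure in the direction `s`. -/
def startCon (k : Kind) (b : Bool) (c : Con) : Con :=
  ⟨k, ⊥, c.toks.map fun t => { t with mark := if b then fun d => decide (d = t.side) else ⊥ }⟩

/-- The result of `select`. -/
def selectForm : Bool → List Con → List Con
  | _, [] => []
  | b, c :: F => match c.kind with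
    | .todo => if b then startCon .todo false c :: selectForm b F
        else startCon .cur true c :: selectForm true F
    | .cur => startCon .done false c :: selectForm b F
    | k => startCon k false c :: selectForm b F

/-- The internal variables between the parts of the program. -/
def st (bad : Bool) (conj : Bool → Mark) : Var := { bad := bad, conj := conj }

/-! #### The table of names -/

theorem scan_nil (v : Var) (S : ∀ k, List (Cell k)) (h : S (.wk .V) = []) :
    scan.den (v, S) = (v, S) :=
  Prog.den_drain_nil _ _ _ _ _ _ h

/-- The letters compared go from `Y` to `X`, from which they are restored later. `neq` records a
mismatch or that `Y` ran out; the other scratch variables no longer matter, hence the existential.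
-/
theorem scan_bits (p : List Bool) (v : Var) (m : Mem) (q X W V : List Sym) :
    ∃ s : Scratch, s.neq = (v.scr.neq || !decide (q.take p.length = p.map Sym.bit)) ∧
    scan.den (v, { m with V := p.map Sym.bit ++ V, Y := q, X := X, W := W }.fn) =
      scan.den ({ v with scr := s }, { m with
        V := V, Y := q.drop p.length, X := (q.take p.length).reverse ++ X,
        W := (p.map Sym.bit).reverse ++ W }.fn) := by
  induction p generalizing v q X W with
  | nil => exact ⟨v.scr, by simp, by simp⟩
  | cons b p ih =>
    cases q with
    | nil =>
      obtain ⟨s, hs, h⟩ := ih { v with scr := { v.scr with isOcc := false, cmp := b, neq := true } } []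
        X (Sym.bit b :: W)
      refine ⟨s, by simpa using hs, ?_⟩
      rw [scan, Prog.den_drain_cons _ _ _ _ rfl rfl _ _ (Sym.bit b) (p.map Sym.bit ++ V) rfl, ← scan]
      simpa [Emit.run, scanVar, scanBody, Prog.den] using h
    | cons a q =>
      obtain ⟨s, hs, h⟩ := ih { v with scr := {
        v.scr with isOcc := false, cmp := b, neq := v.scr.neq || !decide (a = .bit b) } } q (a :: X) (Sym.bit b :: W)
      refine ⟨s, ?_, ?_⟩
      · rw [hs]
        simp [Bool.or_assoc]
      · rw [scan, Prog.den_drain_cons _ _ _ _ rfl rfl _ _ (Sym.bit b) (p.map Sym.bit ++ V) rfl, ← scan]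
        simpa [Emit.run, scanVar, scanBody, Prog.den] using h

theorem scan_entry (p y : List Bool) (v : Var) (hv : v.scr = {}) (m : Mem) (mu : Mark)
    (W V : List Sym) :
    scan.den (v, { m with
        V := p.map Sym.bit ++ Sym.occ false mu :: V, Y := y.map Sym.bit, X := [], W := W }.fn) =
      scan.den ({ v with mark := if p = y then v.mark ⊔ mu else v.mark }, { m with
        V := V, Y := y.map Sym.bit, X := [],
        W := Sym.occ false (if p = y then v.mark ⊔ mu else mu) ::
          ((p.map Sym.bit).reverse ++ W) }.fn) := by
  obtain ⟨s, hs, h⟩ := scan_bits p v m (y.map Sym.bit) [] W (Sym.occ false mu :: V)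
  rw [h, scan, Prog.den_drain_cons _ _ _ _ rfl rfl _ _ (Sym.occ false mu) V rfl, ← scan]
  clear h
  rw [hv] at hs
  have hinj : Injective (List.map Sym.bit) :=
    List.map_injective_iff.2 fun a b h => by simpa using h
  -- The two tests of the program: equality with the first letters of `Y`, then whether `Y` is
  -- exhausted. Together they decide equality of the names.
  have key : ((y.map Sym.bit).take p.length = p.map Sym.bit ∧ (y.map Sym.bit).drop p.length = []) ↔
      p = y := by
    constructor
    · rintro ⟨h₁, h₂⟩
      have := List.take_append_drop p.length (y.map Sym.bit)
      rw [h₁, h₂, List.append_nil] at this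
      exact hinj this
    · rintro rfl
      simp
  have hre := List.take_append_drop p.length (y.map Sym.bit)
  cases hd : (y.map Sym.bit).drop p.length with
  | nil =>
    rw [hd, List.append_nil] at hre
    simp only [hd, and_true] at key
    by_cases hpy : p = y
    · have hn : s.neq = false := by rw [hs]; simp [key.2 hpy]
      simp [Emit.run, scanVar, scanBody, Prog.den, hn, den_move, hpy, hv]
      rw [← hpy] at hre ⊢
      rw [hre]
    · have hn : s.neq = true := by rw [hs]; simp [mt key.1 hpy]
      simp [Emit.run, scanVar, scanBody, Prog.den, hn, den_move, hpy, skip, hre, hv]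
  | cons a l =>
    have hpy : p ≠ y := fun h => by simp [key.2 h] at hd
    simp [Emit.run, scanVar, scanBody, Prog.den, den_move, hpy, skip, hv]
    rw [← hd, hre]

/-- `T` may list a name several times, once per occurrence in the input. All its entries carry the
same mark `μ y` and receive the same new one, as joining `μ y` twice changes nothing. -/
theorem scan_table (T : List Name) (μ : Name → Mark) (y : Name) (v : Var) (hv : v.scr = {}) (m : Mem)
    (W V : List Sym) :
    scan.den (v, { m with
        V := (encTable T μ).reverse ++ V, Y := (y.map Sym.bit).reverse, X := [], W := W }.fn) =
      scan.den ({ v with mark := if y ∈ T then v.mark ⊔ μ y else v.mark }, { m with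
        V := V, Y := (y.map Sym.bit).reverse, X := [],
        W := encTable T (update μ y (v.mark ⊔ μ y)) ++ W }.fn) := by
  induction T generalizing W V with
  | nil => simp [encTable]
  | cons x T ih =>
    have h₁ : (encTable (x :: T) μ).reverse ++ V =
        (encTable T μ).reverse ++ (x.reverse.map Sym.bit ++ Sym.occ false (μ x) :: V) := by
      simp [encTable]
    rw [h₁, ih]
    have h₂ := scan_entry x.reverse y.reverse
      { v with mark := if y ∈ T then v.mark ⊔ μ y else v.mark } hv m (μ x)
      (encTable T (update μ y (v.mark ⊔ μ y)) ++ W) V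
    rw [List.map_reverse (l := y)] at h₂
    rw [h₂]
    by_cases hxy : x = y
    · subst hxy
      by_cases hT : x ∈ T <;> simp [hT, encTable]
    · have hxy' : ¬ y = x := fun h => hxy h.symm
      simp [hxy, hxy', encTable]

theorem den_lookup (T : List Name) (μ : Name → Mark) (x : Name) (hx : x ∈ T) (v : Var)
    (hv : v.scr = {}) (m : Mem) (hW : m.W = []) (hY : m.Y = []) (hX : m.X = x.map Sym.bit)
    (hV : m.V = (encTable T μ).reverse) :
    lookup.den (v, m.fn) = ({ v with mark := v.mark ⊔ μ x }, { m with
        V := (encTable T (update μ x (v.mark ⊔ μ x))).reverse, L := x.map Sym.bit ++ m.L,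
        X := [] }.fn) := by
  have h := (scan_table T μ x v hv m [] []).trans (scan_nil _ _ rfl)
  rw [if_pos hx] at h
  obtain ⟨inp, R, L, V, W, X, Y, Z, N, C, D, E⟩ := m
  dsimp only at hW hY hX hV
  subst hW hY hX hV
  simp [lookup, Prog.den, den_move] at h ⊢
  simp [h, den_move]

/-! #### One round -/

theorem collect_bits (x : List Bool) (v : Var) (hv : v.scr = {}) (m : Mem) (X R : List Sym) :
    collect.den (v, { m with R := x.map Sym.bit ++ R, X := X }.fn) =
      collect.den (v, { m with R := R, X := (x.map Sym.bit).reverse ++ X }.fn) := by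
  induction x generalizing X with
  | nil => rfl
  | cons b x ih =>
    rw [collect, Prog.den_drain_cons _ _ _ _ rfl rfl _ _ (Sym.bit b) (x.map Sym.bit ++ R) rfl,
      ← collect]
    have := ih (Sym.bit b :: X)
    obtain ⟨_, _, _, _, _, _, _, _⟩ := v
    dsimp only at hv
    subst hv
    simpa [Emit.run, collectVar, Prog.den, skip, Sym.isBit] using this

theorem collect_tok (T : List Name) (μ : Name → Mark) (t : Tok) (ht : t.name ∈ T) (bad : Bool)
    (conj : Bool → Mark) (L R C D E : List Sym) :
    collect.den (st bad conj, Mem.fn {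
        R := (encTok t).reverse ++ R, L := L, V := (encTable T μ).reverse, C := C, D := D, E := E }) =
      collect.den (st bad (update conj t.side (conj t.side ⊓ (t.mark ⊔ μ t.name))), Mem.fn {
        R := R, L := encTok { t with mark := t.mark ⊔ μ t.name } ++ L,
        V := (encTable T (update μ t.name (t.mark ⊔ μ t.name))).reverse, C := C, D := D, E := E }) := by
  have h := collect_bits t.name.reverse (st bad conj) rfl
    { L := L, V := (encTable T μ).reverse, C := C, D := D, E := E } [] (Sym.occ t.side t.mark :: R)
  have hR : (encTok t).reverse ++ R =
      t.name.reverse.map Sym.bit ++ Sym.occ t.side t.mark :: R := by simp [encTok]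
  rw [hR, h, collect, Prog.den_drain_cons _ _ _ _ rfl rfl _ _ (Sym.occ t.side t.mark) R rfl,
      ← collect]
  have hl := den_lookup T μ t.name ht { st bad conj with side := t.side, mark := t.mark } rfl
    { R := R, X := t.name.map Sym.bit, L := L, V := (encTable T μ).reverse, C := C, D := D, E := E,
      Z := [Sym.occ t.side t.mark] } rfl rfl rfl rfl
  simp only [st] at hl ⊢
  simp [Emit.run, collectVar, Prog.den, Sym.isBit, Sym.isHead, hl, encTok]

theorem collect_head (bad : Bool) (conj : Bool → Mark) (k : Kind) (fr : Mark) (L R V C D E : List Sym) :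
    collect.den (st bad conj, Mem.fn {
        R := .head k fr :: R, L := L, V := V, C := C, D := D, E := E }) =
      collect.den (st (bad || (decide (k = .cur) && decide (conj false ⊓ conj true = ⊤))) ⊤, Mem.fn {
        R := R, L := .head k (if k = .eq then conj false ⊔ conj true else ⊥) :: L,
        V := V, C := C, D := D, E := E }) := by
  rw [collect, Prog.den_drain_cons _ _ _ _ rfl rfl _ _ (Sym.head k fr) R rfl, ← collect]
  simp [Emit.run, collectVar, Prog.den, Sym.isBit, Sym.isHead, st, skip, collectHead]

/-- The last occurrence is popped first, which is why `syncToks` and `conjOf` treat the tail before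
the head. -/
theorem collect_toks (T : List Name) (μ : Name → Mark) (ts : List Tok) (hts : ∀ t ∈ ts, t.name ∈ T)
    (bad : Bool) (L R C D E : List Sym) :
    collect.den (st bad ⊤, Mem.fn {
        R := (ts.flatMap encTok).reverse ++ R, L := L, V := (encTable T μ).reverse,
        C := C, D := D, E := E }) =
      collect.den (st bad (conjOf (syncToks ts μ).1), Mem.fn {
        R := R, L := (syncToks ts μ).1.flatMap encTok ++ L,
        V := (encTable T (syncToks ts μ).2).reverse, C := C, D := D, E := E }) := by
  induction ts generalizing R with
  | nil => rfl
  | cons t ts ih =>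
    rw [List.flatMap_cons, List.reverse_append, List.append_assoc,
      ih (fun t h => hts t (List.mem_cons_of_mem _ h)),
      collect_tok T _ t (hts t List.mem_cons_self)]
    simp [syncToks, conjOf]

theorem collect_form (T : List Name) (μ : Name → Mark) (F : List Con)
    (hF : ∀ c ∈ F, ∀ t ∈ c.toks, t.name ∈ T) (bad : Bool) (R L C D E : List Sym) :
    collect.den (st bad ⊤, Mem.fn {
        R := (encForm F).reverse ++ R, L := L, V := (encTable T μ).reverse,
        C := C, D := D, E := E }) =
      collect.den (st (bad || (collectForm F μ).1.any Con.bad) ⊤, Mem.fn {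
        R := R, L := encForm (collectForm F μ).1 ++ L,
        V := (encTable T (collectForm F μ).2).reverse, C := C, D := D, E := E }) := by
  induction F generalizing R with
  | nil => simp [encForm, collectForm]
  | cons c F ih =>
    have h₁ : (encForm (c :: F)).reverse ++ R = (encForm F).reverse ++
        ((c.toks.flatMap encTok).reverse ++ Sym.head c.kind c.fire :: R) := by
      simp [encForm, encCon]
    rw [h₁, ih (fun c h => hF c (List.mem_cons_of_mem _ h)),
      collect_toks T _ _ (hF c List.mem_cons_self), collect_head]
    simp [collectForm, encForm, encCon, collectCon, Con.bad, Bool.or_assoc, Bool.or_comm]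

theorem passFold_spread_toks (ts : List Tok) (v : Var) (l acc : List Sym) :
    passFold spreadVar spreadSym (ts.flatMap encTok ++ l) v acc =
      passFold spreadVar spreadSym l v
        (((ts.map fun t => { t with mark := t.mark ⊔ v.fire }).flatMap encTok).reverse ++ acc) := by
  have bits (x : Name) (l acc : List Sym) :
      passFold spreadVar spreadSym (x.map Sym.bit ++ l) v acc =
        passFold spreadVar spreadSym l v ((x.map Sym.bit).reverse ++ acc) := by
    induction x generalizing acc with
    | nil => rfl
    | cons b x ih => simp [passFold, spreadVar, spreadSym, ih]
  induction ts generalizing acc with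
  | nil => rfl
  | cons t ts ih => simp [encTok, passFold, spreadVar, spreadSym, bits, ih]

/-- The final value of `fire` is left open, because `round` resets it. -/
theorem passFold_spread (F : List Con) (v : Var) (acc : List Sym) :
    ∃ fr, passFold spreadVar spreadSym (encForm F) v acc =
      ({ v with fire := fr }, (encForm (F.map spreadCon)).reverse ++ acc) := by
  induction F generalizing v acc with
  | nil => exact ⟨v.fire, rfl⟩
  | cons c F ih =>
    obtain ⟨fr, h⟩ := ih { v with fire := c.fire }
      (((c.toks.map fun t => { t with mark := t.mark ⊔ c.fire }).flatMap encTok).reverse ++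
        .head c.kind ⊥ :: acc)
    refine ⟨fr, ?_⟩
    simp only [encForm, List.flatMap_cons, encCon, List.cons_append, passFold, spreadVar, spreadSym]
    rw [passFold_spread_toks]
    simpa [encForm, encCon, spreadCon] using h

theorem den_round (T : List Name) (μ : Name → Mark) (F : List Con)
    (hF : ∀ c ∈ F, ∀ t ∈ c.toks, t.name ∈ T) (bad : Bool) (C D E : List Sym) :
    round.den (st bad ⊤, Mem.fn {
        R := (encForm F).reverse, V := (encTable T μ).reverse, C := C, D := D, E := E }) =
      (st (roundForm (F, μ, bad)).2.2 ⊤, Mem.fn {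
        R := (encForm (roundForm (F, μ, bad)).1).reverse,
        V := (encTable T (roundForm (F, μ, bad)).2.1).reverse, C := C, D := D, E := E }) := by
  have h := collect_form T μ F hF bad [] [] C D E
  rw [List.append_nil, List.append_nil] at h
  obtain ⟨fr, h'⟩ := passFold_spread (collectForm F μ).1
    (st (bad || (collectForm F μ).1.any Con.bad) ⊤) []
  have hnil (v : Var) (S : ∀ k, List (Cell k)) (h : S (.wk .R) = []) :
    collect.den (v, S) = (v, S) := Prog.den_drain_nil _ _ _ _ _ _ h
  rw [round, Prog.den, h, hnil _ _ rfl]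
  simp only [st] at h'
  simp [Prog.den, den_pass, h', roundForm, st]

end SemilatticeCSP

namespace SemilatticeCSP

open StackProg Function

/-! #### Choosing a disequality -/

theorem passFold_select_toks (ts : List Tok) (v : Var) (l acc : List Sym) :
    passFold selectVar selectSym (ts.flatMap encTok ++ l) v acc =
      passFold selectVar selectSym l v
        (((ts.map fun t => { t with
          mark := if v.cur then fun d => decide (d = t.side) else ⊥ }).flatMap encTok).reverse ++
          acc) := by
  have bits (x : Name) (l acc : List Sym) :
      passFold selectVar selectSym (x.map Sym.bit ++ l) v acc =
        passFold selectVar selectSym l v ((x.map Sym.bit).reverse ++ acc) := by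
    induction x generalizing acc with
    | nil => rfl
    | cons b x ih => simp [passFold, selectVar, selectSym, ih]
  induction ts generalizing acc with
  | nil => rfl
  | cons t ts ih => simp [encTok, passFold, selectVar, selectSym, bits, ih]

theorem passFold_select (F : List Con) (v : Var) (acc : List Sym) :
    ∃ s c, passFold selectVar selectSym (encForm F) v acc =
      ({ v with sel := s, cur := c }, (encForm (selectForm v.sel F)).reverse ++ acc) := by
  induction F generalizing v acc with
  | nil => exact ⟨v.sel, v.cur, rfl⟩
  | cons c F ih =>
    obtain ⟨k, fr, ts⟩ := c
    obtain ⟨s, b, h⟩ := ih (selectVar v (.head k fr))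
      (((ts.map fun t => { t with
        mark := if (selectVar v (.head k fr)).cur then fun d => decide (d = t.side) else ⊥
      }).flatMap encTok).reverse ++ selectSym v (.head k fr) :: acc)
    refine ⟨s, b, ?_⟩
    simp only [encForm, List.flatMap_cons, encCon, List.cons_append, passFold]
    rw [passFold_select_toks]
    refine h.trans ?_
    cases k <;> cases hs : v.sel <;>
      simp [encForm, encCon, selectVar, selectSym, selectForm, startCon, hs]

theorem map_reset_encTable (T : List Name) (μ : Name → Mark) :
    (encTable T μ).map resetSym = encTable T ⊥ := by
  simp only [encTable, List.map_flatMap]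
  congr 1
  funext x
  simp [resetSym]

theorem den_select (T : List Name) (μ : Name → Mark) (F : List Con) (bad : Bool)
    (C E : List Sym) :
    select.den (st bad ⊤, Mem.fn {
        R := (encForm F).reverse, V := (encTable T μ).reverse, C := C, E := E }) =
      (st bad ⊤, Mem.fn {
        R := (encForm (selectForm false F)).reverse, V := (encTable T ⊥).reverse,
        C := C, E := E }) := by
  obtain ⟨s, c, h⟩ := passFold_select F (st bad ⊤) []
  simp only [st] at h
  simp [select, Prog.den, den_move, den_pass, h, st, passFold_const, map_reset_encTable]

/-! #### Saturation -/

/-- The formula without its marks. -/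
def shape (F : List Con) : List (Kind × List (Bool × Name)) :=
  F.map fun c => (c.kind, c.toks.map fun t => (t.side, t.name))

theorem shape_syncToks (ts : List Tok) (μ : Name → Mark) :
    (syncToks ts μ).1.map (fun t => (t.side, t.name)) = ts.map fun t => (t.side, t.name) := by
  induction ts with
  | nil => rfl
  | cons t ts ih => simp [syncToks, ih]

theorem shape_collectForm (F : List Con) (μ : Name → Mark) :
    shape (collectForm F μ).1 = shape F := by
  induction F with
  | nil => rfl
  | cons c F ih =>
    simp only [shape] at ih ⊢
    simp [collectForm, collectCon, shape_syncToks, ih]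

theorem shape_map_spreadCon (F : List Con) : shape (F.map spreadCon) = shape F := by
  simp [shape, spreadCon, Function.comp_def]

theorem shape_roundForm (s : List Con × (Name → Mark) × Bool) :
    shape (roundForm s).1 = shape s.1 := by
  rw [roundForm, shape_map_spreadCon, shape_collectForm]

theorem shape_iterate_roundForm (n : ℕ) (s : List Con × (Name → Mark) × Bool) :
    shape (roundForm^[n] s).1 = shape s.1 := by
  induction n generalizing s with
  | zero => rfl
  | succ n ih => rw [iterate_succ_apply, ih, shape_roundForm]

/-- All names in the formula are in the table. -/
def Covers (T : List Name) (S : List (Kind × List (Bool × Name))) : Prop :=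
  ∀ c ∈ S, ∀ p ∈ c.2, p.2 ∈ T

theorem Covers.mem {T : List Name} {F : List Con} (h : Covers T (shape F)) (c : Con) (hc : c ∈ F)
    (t : Tok) (ht : t ∈ c.toks) : t.name ∈ T :=
  h _ (List.mem_map_of_mem hc) _ (List.mem_map_of_mem (f := fun t : Tok => (t.side, t.name)) ht)

/-- The letters of `C` pass to `D` and return, so the same number of rounds is available for the
next disequality. -/
theorem den_saturate (T : List Name) (s : List Con × (Name → Mark) × Bool)
    (hF : Covers T (shape s.1)) (C E : List Sym) :
    saturate.den (st s.2.2 ⊤, Mem.fn {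
        R := (encForm s.1).reverse, V := (encTable T s.2.1).reverse, C := C, E := E }) =
      (st (roundForm^[C.length] s).2.2 ⊤, Mem.fn {
        R := (encForm (roundForm^[C.length] s).1).reverse,
        V := (encTable T (roundForm^[C.length] s).2.1).reverse, C := C, E := E }) := by
  have key (l D : List Sym) (s : List Con × (Name → Mark) × Bool) (hF : Covers T (shape s.1)) :
      Prog.den (.drain (.wk .C) (fun v _ => v) (.push (.wk .D) (fun _ a => a) .nil) round)
        (st s.2.2 ⊤, Mem.fn {
          R := (encForm s.1).reverse, V := (encTable T s.2.1).reverse, C := l, D := D, E := E }) =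
        (st (roundForm^[l.length] s).2.2 ⊤, Mem.fn {
          R := (encForm (roundForm^[l.length] s).1).reverse,
          V := (encTable T (roundForm^[l.length] s).2.1).reverse, D := l.reverse ++ D, E := E }) := by
    induction l generalizing D s with
    | nil => rw [Prog.den_drain_nil _ _ _ _ _ _ rfl]; simp
    | cons a l ih =>
      rw [Prog.den_drain_cons _ _ _ _ rfl rfl _ _ a l rfl]
      have h := den_round T s.2.1 s.1 hF.mem s.2.2 l (a :: D) E
      simp only [Emit.run, update_C, update_D, fn_D]
      rw [h, ih (a :: D) (roundForm s) (by rwa [shape_roundForm])]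
      simp
  rw [saturate, Prog.den, key C [] s hF, den_move (by decide)]
  simp

/-- The result of checking one disequality, with `n` rounds of the closure. -/
def checkForm (n : ℕ) (s : List Con × Bool) : List Con × Bool :=
  ((roundForm^[n] (selectForm false s.1, ⊥, s.2)).1,
    (roundForm^[n] (selectForm false s.1, ⊥, s.2)).2.2)

theorem snd_shape_selectForm (b : Bool) (F : List Con) :
    (shape (selectForm b F)).map Prod.snd = (shape F).map Prod.snd := by
  induction F generalizing b with
  | nil => rfl
  | cons c F ih =>
    simp only [shape, List.map_map, Function.comp_def] at ih ⊢
    unfold selectForm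
    rcases hk : c.kind <;> cases b <;> simp [startCon, ih]

theorem Covers.selectForm {T : List Name} {F : List Con} (h : Covers T (shape F)) (b : Bool) :
    Covers T (shape (selectForm b F)) := by
  intro c hc p hp
  have : c.2 ∈ (shape F).map Prod.snd := by
    rw [← snd_shape_selectForm b]; exact List.mem_map_of_mem hc
  obtain ⟨c', hc', he⟩ := List.mem_map.1 this
  exact h c' hc' p (he ▸ hp)

theorem den_check (T : List Name) (E C : List Sym) (F : List Con) (hF : Covers T (shape F))
    (μ : Name → Mark) (bad : Bool) :
    ∃ μ', check.den (st bad ⊤, Mem.fn {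
        R := (encForm F).reverse, V := (encTable T μ).reverse, C := C, E := E }) =
      (st ((checkForm C.length)^[E.length] (F, bad)).2 ⊤, Mem.fn {
        R := (encForm ((checkForm C.length)^[E.length] (F, bad)).1).reverse,
        V := (encTable T μ').reverse, C := C }) := by
  induction E generalizing F bad μ with
  | nil => exact ⟨μ, by rw [check, Prog.den_drain_nil _ _ _ _ _ _ rfl]; rfl⟩
  | cons a E ih =>
    have h := den_saturate T (selectForm false F, ⊥, bad) (hF.selectForm false) C E
    obtain ⟨μ', h'⟩ := ih (checkForm C.length (F, bad)).1
      (by rw [checkForm, shape_iterate_roundForm]; exact hF.selectForm false)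
      (roundForm^[C.length] (selectForm false F, ⊥, bad)).2.1 (checkForm C.length (F, bad)).2
    refine ⟨μ', ?_⟩
    rw [check, Prog.den_drain_cons _ _ _ _ rfl rfl _ _ a E rfl, ← check]
    simp only [Emit.run, update_E, Prog.den]
    rw [den_select]
    simp only at h
    rw [h, List.length_cons, iterate_succ_apply]
    exact h'

/-! #### Reading the input -/

/-- The state while the input is read: the current side, the contents of `R` and `V`, and the number
of letters on `N`. -/
structure ParseState : Type where
  side : Bool := false
  R : List Sym := []
  V : List Sym := []
  n : ℕ := 0

/-- Read one letter. -/
def parseStep (s : ParseState) : Letter → ParseState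
  | .eq => { s with side := false, R := .head .eq ⊥ :: s.R }
  | .ne => { s with side := false, R := .head .todo ⊥ :: s.R }
  | .meet => { s with n := s.n + 1 }
  | .var => ⟨s.side || decide (s.n = 0), .occ s.side ⊥ :: s.R, .occ false ⊥ :: s.V, s.n - 1⟩
  | .bit b => { s with R := .bit b :: s.R, V := .bit b :: s.V }

theorem den_parse (w : List Letter) (s : ParseState) (c : ℕ) :
    parse.den ({ side := s.side }, Mem.fn {
        inp := w, R := s.R, V := s.V, N := .replicate s.n (.bit false),
        C := .replicate (4 * c) (.bit false), E := .replicate c (.bit false) }) =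
      ({ side := (w.foldl parseStep s).side }, Mem.fn {
        R := (w.foldl parseStep s).R, V := (w.foldl parseStep s).V,
        N := .replicate (w.foldl parseStep s).n (.bit false),
        C := .replicate (4 * (c + w.length)) (.bit false),
        E := .replicate (c + w.length) (.bit false) }) := by
  induction w generalizing s c with
  | nil => rw [parse, Prog.den_drain_nil _ _ _ _ _ _ rfl]; rfl
  | cons a w ih =>
    rw [parse, Prog.den_drain_cons _ _ _ _ rfl rfl _ _ a w rfl, ← parse]
    have h := ih (parseStep s a) (c + 1)
    rw [List.foldl_cons, List.length_cons, show c + (w.length + 1) = c + 1 + w.length by omega,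
      ← h]
    congr 1
    obtain ⟨side, R, V, n⟩ := s
    cases n <;> cases a <;> simp [Emit.run, Prog.den, parseStep, parseVar, parseSym, parseName,
      Letter.isMeet, Letter.inVar, skip, Nat.mul_add, List.replicate_succ]

/-- The variables of a term. -/
def termVars : meetLang.Term ℕ → List ℕ
  | .var n => [n]
  | .func (l := _) f ts => match f, ts with
    | MeetSymbol.meet, ts => termVars (ts 0) ++ termVars (ts 1)

/-- The names of the variables of a term. -/
def termNames (t : meetLang.Term ℕ) : List Name := (termVars t).map Computability.encodeNat

/-- The occurrences of variables in a term, on the side `b`. -/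
def termToks (b : Bool) (t : meetLang.Term ℕ) : List Tok := (termNames t).map fun x => ⟨b, x, ⊥⟩

/-- A constraint in the form on which the program works. -/
def conOf : Constraint meetLang → Con
  | .eq s t => ⟨.eq, ⊥, termToks false s ++ termToks true t⟩
  | .ne s t => ⟨.todo, ⊥, termToks false s ++ termToks true t⟩

/-- The names of the variables of a constraint. -/
def conNames : Constraint meetLang → List Name
  | .eq s t => termNames s ++ termNames t
  | .ne s t => termNames s ++ termNames t

theorem foldl_parseStep_bits (x : List Bool) (s : ParseState) :
    (x.map Letter.bit).foldl parseStep s = { s with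
      R := (x.map Sym.bit).reverse ++ s.R, V := (x.map Sym.bit).reverse ++ s.V } := by
  induction x generalizing s with
  | nil => rfl
  | cons b x ih => simp [parseStep, ih]

/-- `n` counts the operands still missing after the current one. A `meet` adds one and every
complete term uses one up; a term read at `n = 0` completes the left side, so the side flips. The
truncated `n - 1` leaves the counter at 0 there. -/
theorem foldl_parseStep_term (t : meetLang.Term ℕ) (s : ParseState) :
    (encodeTerm t).foldl parseStep s = ⟨s.side || decide (s.n = 0),
      ((termToks s.side t).flatMap encTok).reverse ++ s.R,
      (encTable (termNames t) ⊥).reverse ++ s.V, s.n - 1⟩ := by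
  induction t generalizing s with
  | var n =>
    simp [encodeTerm, parseStep, foldl_parseStep_bits, termToks, termNames, termVars, encTok,
      encTable]
  | func f ts ih =>
    obtain ⟨⟩ := f
    simp [encodeTerm, parseStep, ih, termToks, termNames, termVars, encTable]

theorem foldl_parseStep_instance (φ : List (Constraint meetLang)) (s : ParseState) (hs : s.n = 0) :
    ∃ b, (encodeInstance φ).foldl parseStep s = ⟨b,
      (encForm (φ.map conOf)).reverse ++ s.R,
      (encTable (φ.flatMap conNames) ⊥).reverse ++ s.V, 0⟩ := by
  induction φ generalizing s with
  | nil => exact ⟨s.side, by cases s; simp_all [encodeInstance, encForm, encTable]⟩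
  | cons c φ ih =>
    obtain ⟨b, h⟩ := ih ((encodeConstraint c).foldl parseStep s) (by
      cases c <;> simp [encodeConstraint, parseStep, foldl_parseStep_term, hs])
    refine ⟨b, ?_⟩
    simp only [encodeInstance, List.flatMap_cons, List.foldl_append] at h ⊢
    rw [h]
    cases c <;> simp [encodeConstraint, parseStep, foldl_parseStep_term, hs, encForm, encTable,
      encCon, conOf, conNames]

theorem fn_empty : Mem.fn {} = fun _ => [] := by
  funext k; rcases k with _ | _ | i <;> [rfl; rfl; (cases i <;> rfl)]

theorem single_inp (w : List Letter) : single .inp w = Mem.fn { inp := w } := by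
  rw [← update_inp {} w, fn_empty]
  rfl

theorem covers_instance (φ : List (Constraint meetLang)) :
    Covers (φ.flatMap conNames) (shape (φ.map conOf)) := by
  intro c hc p hp
  simp only [shape, List.map_map, List.mem_map] at hc
  obtain ⟨a, ha, rfl⟩ := hc
  refine List.mem_flatMap.2 ⟨a, ha, ?_⟩
  cases a <;>
  · simp only [Function.comp_apply, conOf, termToks, List.map_append, List.map_map, List.mem_append, List.mem_map] at hp
    simp only [conNames, List.mem_append]
    rcases hp with ⟨x, hx, rfl⟩ | ⟨x, hx, rfl⟩
    exacts [.inl hx, .inr hx]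

theorem den_solve (φ : List (Constraint meetLang)) :
    solve.den ({}, single .inp (encodeInstance φ)) =
      (st ((checkForm (4 * (encodeInstance φ).length))^[(encodeInstance φ).length]
        (φ.map conOf, false)).2 ⊤, fun _ => []) := by
  have h₁ := den_parse (encodeInstance φ) {} 0
  obtain ⟨b, h₂⟩ := foldl_parseStep_instance φ {} rfl
  obtain ⟨μ, h₃⟩ := den_check (φ.flatMap conNames)
    (.replicate (encodeInstance φ).length (.bit false))
    (.replicate (4 * (encodeInstance φ).length) (.bit false)) (φ.map conOf) (covers_instance φ) ⊥ false
  rw [h₂] at h₁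
  simp only [List.replicate_zero, List.append_nil, mul_zero, zero_add] at h₁
  rw [single_inp, solve, Prog.den, h₁]
  rw [Prog.den, Prog.den, Prog.den, show ({} : Var) = st false ⊤ from rfl, h₃]
  simp only [Prog.den, den_clear, update_R, update_V, update_C, List.length_replicate]
  rw [← fn_empty]

end SemilatticeCSP

namespace SemilatticeCSP

open Function

/-! ### Correctness of the closure -/

/-- The occurrences of variables in a constraint: pairs of a side and a name. -/
abbrev Sides : Type := List (Bool × Name)

/-- All names on the side `d` satisfy `w`. -/
def Holds (w : Name → Prop) (ps : Sides) (d : Bool) : Prop := ∀ p ∈ ps, p.1 = d → w p.2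

/-- The set `w` satisfies the equations `E`. -/
def EqSat (E : List Sides) (w : Name → Prop) : Prop := ∀ ps ∈ E, (Holds w ps false ↔ Holds w ps true)

/-- The equations `E` entail the equation `ps` in the two-element semilattice. -/
def Entails (E : List Sides) (ps : Sides) : Prop :=
  ∀ w, EqSat E w → ∀ d, Holds w ps d → ∀ p ∈ ps, w p.2

/-- The names that can be derived in `j` steps from one side of `ps`. -/
def Der (E : List Sides) (ps : Sides) (d : Bool) : ℕ → Name → Prop
  | 0, x => (d, x) ∈ ps
  | j + 1, x => Der E ps d j x ∨
      ∃ qs ∈ E, (∃ s, Holds (Der E ps d j) qs s) ∧ ∃ p ∈ qs, p.2 = x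

theorem Der.mono {E : List Sides} {ps : Sides} {d : Bool} {i j : ℕ} (h : i ≤ j) {x : Name}
    (hx : Der E ps d i x) : Der E ps d j x := by
  induction j, h using Nat.le_induction with
  | base => exact hx
  | succ j _ ih => exact Or.inl ih

theorem Der.mem {E : List Sides} {ps : Sides} {T : List Name} (hE : ∀ qs ∈ E, ∀ p ∈ qs, p.2 ∈ T)
    (hps : ∀ p ∈ ps, p.2 ∈ T) {d : Bool} {j : ℕ} {x : Name} (hx : Der E ps d j x) : x ∈ T := by
  induction j with
  | zero => exact hps _ hx
  | succ j ih =>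
    obtain h | ⟨qs, hqs, -, p, hp, rfl⟩ := hx
    · exact ih h
    · exact hE qs hqs p hp

/-- The derivation becomes stationary. -/
theorem Der.exists_stationary {E : List Sides} {ps : Sides} {T : List Name}
    (hE : ∀ qs ∈ E, ∀ p ∈ qs, p.2 ∈ T) (hps : ∀ p ∈ ps, p.2 ∈ T) (d : Bool) :
    ∃ j ≤ T.length, ∀ x, Der E ps d (j + 1) x → Der E ps d j x := by
  classical
  by_contra! H
  let A (j : ℕ) : Finset Name := T.toFinset.filter (Der E ps d j)
  -- Without a stationary stage every stage adds a name, so stage `T.length + 1` would contain more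
  -- names than `T` has.
  have hA (j : ℕ) (hj : j ≤ T.length + 1) : j ≤ (A j).card := by
    induction j with
    | zero => exact Nat.zero_le _
    | succ j ih =>
      obtain ⟨x, hx, hx'⟩ := H j (by omega)
      refine (Nat.succ_le_succ (ih (by omega))).trans (Finset.card_lt_card ?_)
      refine Finset.ssubset_iff_of_subset ?_ |>.2 ⟨x, ?_, ?_⟩
      · intro y hy
        simp only [A, Finset.mem_filter] at hy ⊢
        exact ⟨hy.1, Or.inl hy.2⟩
      · simp only [A, Finset.mem_filter, List.mem_toFinset]
        exact ⟨hx.mem hE hps, hx⟩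
      · simp only [A, Finset.mem_filter]
        exact fun h => hx' h.2
  have h₁ := hA _ le_rfl
  have h₂ : (A (T.length + 1)).card ≤ T.length :=
    (Finset.card_filter_le _ _).trans T.toFinset_card_le
  omega

/-- A stationary stage is itself a set that satisfies `E` and contains side `d` of `ps`, so the
entailment applies to it. -/
theorem Entails.der {E : List Sides} {ps : Sides} (h : Entails E ps) {T : List Name}
    (hE : ∀ qs ∈ E, ∀ p ∈ qs, p.2 ∈ T) (hps : ∀ p ∈ ps, p.2 ∈ T) (d : Bool) :
    ∀ p ∈ ps, Der E ps d T.length p.2 := by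
  obtain ⟨j, hj, hst⟩ := Der.exists_stationary hE hps d
  have closed (qs) (hqs : qs ∈ E) (s s' : Bool) (hs : Holds (Der E ps d j) qs s) :
      Holds (Der E ps d j) qs s' :=
    fun p hp _ => hst _ (Or.inr ⟨qs, hqs, ⟨s, hs⟩, p, hp, rfl⟩)
  have h₀ : Holds (Der E ps d j) ps d := by
    rintro ⟨s, x⟩ hp rfl
    exact Der.mono (Nat.zero_le _) (show Der E ps _ 0 x from hp)
  intro p hp
  exact (h _ (fun qs hqs => ⟨closed qs hqs _ _, closed qs hqs _ _⟩) d h₀ p hp).mono hj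

/-! #### Rounds -/

theorem conjOf_eq_true {ts : List Tok} {s d : Bool} :
    conjOf ts s d = true ↔ ∀ t ∈ ts, t.side = s → t.mark d = true := by
  induction ts with
  | nil => simp [conjOf]
  | cons t ts ih =>
    by_cases h : t.side = s
    · subst h
      simp [conjOf, ih, and_comm]
    · have h' : s ≠ t.side := fun e => h e.symm
      simp [conjOf, h, h', ih]

theorem syncToks_le (ts : List Tok) (μ : Name → Mark) (x : Name) (d : Bool) (h : μ x d = true) :
    (syncToks ts μ).2 x d = true := by
  induction ts with
  | nil => exact h
  | cons t ts ih =>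
    by_cases hx : x = t.name
    · subst hx; simp [syncToks, ih]
    · simp [syncToks, hx, ih]

theorem syncToks_mark_le (ts : List Tok) (μ : Name → Mark) (d : Bool) :
    ∀ t ∈ ts, t.mark d = true → (syncToks ts μ).2 t.name d = true := by
  induction ts with
  | nil => simp
  | cons t ts ih =>
    intro t' ht' h
    by_cases hx : t'.name = t.name
    · rcases List.mem_cons.1 ht' with rfl | ht'
      · simp [syncToks, h]
      · simp [syncToks, hx, ← ih t' ht' h]
    · rcases List.mem_cons.1 ht' with rfl | ht'
      · exact absurd rfl hx
      · simp [syncToks, hx, ih t' ht' h]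

theorem le_syncToks_mark (ts : List Tok) (μ : Name → Mark) (d : Bool) :
    ∀ t ∈ (syncToks ts μ).1, μ t.name d = true → t.mark d = true := by
  induction ts with
  | nil => simp [syncToks]
  | cons t ts ih =>
    intro t' ht' h
    rcases List.mem_cons.1 ht' with rfl | ht'
    · simp only at h
      simp [syncToks_le ts μ _ _ h]
    · exact ih t' ht' h

theorem syncToks_sound (ts : List Tok) (μ : Name → Mark) (w : Name → Prop) (d : Bool)
    (hts : ∀ t ∈ ts, t.mark d = true → w t.name) (hμ : ∀ x, μ x d = true → w x) :
    (∀ t ∈ (syncToks ts μ).1, t.mark d = true → w t.name) ∧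
      ∀ x, (syncToks ts μ).2 x d = true → w x := by
  induction ts with
  | nil => exact ⟨by simp [syncToks], hμ⟩
  | cons t ts ih =>
    obtain ⟨h₁, h₂⟩ := ih fun t ht => hts t (List.mem_cons_of_mem _ ht)
    have h₃ : (t.mark ⊔ (syncToks ts μ).2 t.name) d = true → w t.name := by
      intro h
      simp only [Pi.sup_apply, Bool.max_eq_or, Bool.or_eq_true] at h
      exact h.elim (hts t List.mem_cons_self) (h₂ _)
    constructor
    · intro t' ht' h
      rcases List.mem_cons.1 ht' with rfl | ht'
      · exact h₃ h
      · exact h₁ t' ht' h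
    · intro x hx
      by_cases he : x = t.name
      · subst he
        simp only [syncToks, update_self] at hx
        exact h₃ hx
      · simp only [syncToks, update_of_ne he] at hx
        exact h₂ x hx

theorem collectForm_le (F : List Con) (μ : Name → Mark) (x : Name) (d : Bool) (h : μ x d = true) :
    (collectForm F μ).2 x d = true := by
  induction F with
  | nil => exact h
  | cons c F ih => exact syncToks_le _ _ _ _ ih

theorem collectForm_mark_le (F : List Con) (μ : Name → Mark) (d : Bool) :
    ∀ c ∈ F, ∀ t ∈ c.toks, t.mark d = true → (collectForm F μ).2 t.name d = true := by
  induction F with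
  | nil => simp
  | cons c F ih =>
    intro c' hc' t ht h
    rcases List.mem_cons.1 hc' with rfl | hc'
    · exact syncToks_mark_le _ _ _ t ht h
    · exact syncToks_le _ _ _ _ (ih c' hc' t ht h)

/-- Marks in the table at the start reach every occurrence. Marks found during the pass miss the
occurrences already treated, and this costs a second round per derivation step. -/
theorem le_collectForm_mark (F : List Con) (μ : Name → Mark) (d : Bool) :
    ∀ c ∈ (collectForm F μ).1, ∀ t ∈ c.toks, μ t.name d = true → t.mark d = true := by
  induction F with
  | nil => simp [collectForm]
  | cons c F ih =>
    intro c' hc' t ht h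
    rcases List.mem_cons.1 hc' with rfl | hc'
    · exact le_syncToks_mark _ _ _ t ht (collectForm_le _ _ _ _ h)
    · exact ih c' hc' t ht h

theorem collectForm_sound (F : List Con) (μ : Name → Mark) (w : Name → Prop) (d : Bool)
    (hF : ∀ c ∈ F, ∀ t ∈ c.toks, t.mark d = true → w t.name) (hμ : ∀ x, μ x d = true → w x) :
    (∀ c ∈ (collectForm F μ).1, ∀ t ∈ c.toks, t.mark d = true → w t.name) ∧
      ∀ x, (collectForm F μ).2 x d = true → w x := by
  induction F with
  | nil => exact ⟨by simp [collectForm], hμ⟩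
  | cons c F ih =>
    obtain ⟨h₁, h₂⟩ := ih fun c hc => hF c (List.mem_cons_of_mem _ hc)
    obtain ⟨h₃, h₄⟩ := syncToks_sound c.toks _ w d (hF c List.mem_cons_self) h₂
    refine ⟨fun c' hc' => ?_, h₄⟩
    rcases List.mem_cons.1 hc' with rfl | hc'
    · exact h₃
    · exact h₁ c' hc'

theorem collectForm_fire (F : List Con) (μ : Name → Mark) (d : Bool) :
    ∀ c ∈ (collectForm F μ).1,
      (c.fire d = true ↔ c.kind = .eq ∧ ∃ s, conjOf c.toks s d = true) := by
  induction F with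
  | nil => simp [collectForm]
  | cons c F ih =>
    intro c' hc'
    rcases List.mem_cons.1 hc' with rfl | hc'
    · by_cases hk : c.kind = .eq <;> simp [collectCon, hk]
    · exact ih c' hc'

/-! ### Soundness and completeness of the marks -/

/-- The occurrences in the constraints of kind `k`. -/
def ofKind (k : Kind) (S : List (Kind × Sides)) : List Sides :=
  (S.filter fun c => decide (c.1 = k)).map Prod.snd

/-- The sides of a constraint. -/
def Con.sides (c : Con) : Sides := c.toks.map fun t => (t.side, t.name)

theorem mem_ofKind_shape {k : Kind} {F : List Con} {ps : Sides} :
    ps ∈ ofKind k (shape F) ↔ ∃ c ∈ F, c.kind = k ∧ c.sides = ps := by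
  simp only [ofKind, shape, List.mem_map, List.mem_filter, decide_eq_true_eq, Con.sides]
  constructor
  · rintro ⟨_, ⟨⟨c, hc, rfl⟩, hk⟩, rfl⟩
    exact ⟨c, hc, hk, rfl⟩
  · rintro ⟨c, hc, hk, rfl⟩
    exact ⟨_, ⟨⟨c, hc, rfl⟩, hk⟩, rfl⟩

theorem holds_sides {w : Name → Prop} {c : Con} {d : Bool} :
    Holds w c.sides d ↔ ∀ t ∈ c.toks, t.side = d → w t.name := by
  simp [Holds, Con.sides]

theorem forall_mem_sides {w : Name → Prop} {c : Con} :
    (∀ p ∈ c.sides, w p.2) ↔ ∀ t ∈ c.toks, w t.name := by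
  simp [Con.sides]

/-- In direction `d`, only elements of `w` are marked. -/
def Sound (w : Name → Prop) (d : Bool) (s : List Con × (Name → Mark) × Bool) : Prop :=
  (∀ c ∈ s.1, ∀ t ∈ c.toks, t.mark d = true → w t.name) ∧ ∀ x, s.2.1 x d = true → w x

/-- An equation fires in direction `d` only if one whole side is marked. Then `w` contains that side
and, being a model of the equation, the other one too. -/
theorem Sound.roundForm {w : Name → Prop} {d : Bool} {s : List Con × (Name → Mark) × Bool}
    (hs : Sound w d s) (hw : EqSat (ofKind .eq (shape s.1)) w) : Sound w d (roundForm s) := by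
  obtain ⟨h₁, h₂⟩ := collectForm_sound s.1 s.2.1 w d hs.1 hs.2
  refine ⟨fun c hc t ht hm => ?_, h₂⟩
  obtain ⟨c, hc', rfl⟩ := List.mem_map.1 hc
  obtain ⟨t, ht', rfl⟩ := List.mem_map.1 ht
  clear hc ht
  simp only [Pi.sup_apply, Bool.max_eq_or, Bool.or_eq_true] at hm ⊢
  rcases hm with hm | hm
  · exact h₁ c hc' t ht' hm
  obtain ⟨hk, side, hside⟩ := (collectForm_fire _ _ d c hc').1 hm
  rw [conjOf_eq_true] at hside
  rw [← shape_collectForm s.1 s.2.1] at hw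
  have hiff := hw c.sides (mem_ofKind_shape.2 ⟨c, hc', hk, rfl⟩)
  have hd : Holds w c.sides side := holds_sides.2 fun t ht hs => h₁ c hc' t ht (hside t ht hs)
  have hall : ∀ s, Holds w c.sides s := by
    intro s
    cases side <;> cases s <;> first | exact hd | exact hiff.1 hd | exact hiff.2 hd
  exact holds_sides.1 (hall t.side) t ht' rfl

theorem Con.bad_eq_true {c : Con} :
    c.bad = true ↔ c.kind = .cur ∧ ∀ t ∈ c.toks, ∀ d, t.mark d = true := by
  simp only [Con.bad, Bool.and_eq_true, decide_eq_true_eq]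
  refine and_congr_right fun _ => ⟨fun h t ht d => ?_, fun h => ?_⟩
  · have hd := congrFun h d
    simp only [Pi.inf_apply, Bool.min_eq_and, Pi.top_apply, show (⊤ : Bool) = true from rfl, Bool.and_eq_true,
      conjOf_eq_true] at hd
    cases hs : t.side
    · exact hd.1 t ht hs
    · exact hd.2 t ht hs
  · funext d
    simp only [Pi.inf_apply, Bool.min_eq_and, Pi.top_apply, show (⊤ : Bool) = true from rfl, Bool.and_eq_true,
      conjOf_eq_true]
    exact ⟨fun t ht _ => h t ht d, fun t ht _ => h t ht d⟩

/-- Marks in direction `d` stay inside every model that contains side `d`. If the current constraint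
is marked completely in both directions, each such model contains all of its names. -/
theorem iterate_roundForm_bad_sound (n : ℕ) (s : List Con × (Name → Mark) × Bool)
    (ps : Sides) (hcur : ∀ qs ∈ ofKind .cur (shape s.1), qs = ps)
    (hs : ∀ w d, EqSat (ofKind .eq (shape s.1)) w → Holds w ps d → Sound w d s)
    (hb : (roundForm^[n] s).2.2 = true) :
    s.2.2 = true ∨ ofKind .cur (shape s.1) ≠ [] ∧ Entails (ofKind .eq (shape s.1)) ps := by
  induction n generalizing s with
  | zero => exact Or.inl hb
  | succ n ih =>
    rw [iterate_succ_apply] at hb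
    have h := ih (roundForm s) (by rwa [shape_roundForm])
      (by rw [shape_roundForm]; exact fun w d hw hd => (hs w d hw hd).roundForm hw) hb
    rw [shape_roundForm] at h
    refine h.elim (fun h => ?_) Or.inr
    simp only [roundForm, Bool.or_eq_true, List.any_eq_true] at h
    refine h.imp_right ?_
    rintro ⟨c, hc, hbad⟩
    obtain ⟨hk, hm⟩ := Con.bad_eq_true.1 hbad
    have hmem : c.sides ∈ ofKind .cur (shape s.1) := by
      rw [← shape_collectForm s.1 s.2.1]
      exact mem_ofKind_shape.2 ⟨c, hc, hk, rfl⟩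
    refine ⟨List.ne_nil_of_mem hmem, fun w hw d hd => ?_⟩
    have h := (collectForm_sound s.1 s.2.1 w d (hs w d hw hd).1 (hs w d hw hd).2).1 c hc
    rw [← hcur _ hmem, forall_mem_sides]
    exact fun t ht => h t ht (hm t ht d)

theorem iterate_roundForm_bad_mono (n : ℕ) (s : List Con × (Name → Mark) × Bool)
    (hb : s.2.2 = true) : (roundForm^[n] s).2.2 = true := by
  induction n generalizing s with
  | zero => exact hb
  | succ n ih => exact ih _ (by simp [roundForm, hb])

/-- All elements of `w` are marked in the table. -/
def InTable (w : Name → Prop) (d : Bool) (s : List Con × (Name → Mark) × Bool) : Prop :=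
  ∀ x, w x → s.2.1 x d = true

/-- All elements of `w` are marked in the table or in the formula. -/
def InForm (w : Name → Prop) (d : Bool) (s : List Con × (Name → Mark) × Bool) : Prop :=
  ∀ x, w x → s.2.1 x d = true ∨ ∃ c ∈ s.1, ∃ t ∈ c.toks, t.name = x ∧ t.mark d = true

theorem InForm.roundForm {w : Name → Prop} {d : Bool} {s : List Con × (Name → Mark) × Bool}
    (h : InForm w d s) : InTable w d (roundForm s) := by
  intro x hx
  obtain h | ⟨c, hc, t, ht, rfl, hm⟩ := h x hx
  · exact collectForm_le _ _ _ _ h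
  · exact collectForm_mark_le _ _ _ c hc t ht hm

theorem InTable.roundForm {E : List Sides} {ps : Sides} {d : Bool} {j : ℕ}
    {s : List Con × (Name → Mark) × Bool} (h : InTable (Der E ps d j) d s)
    (hE : E = ofKind .eq (shape s.1)) : InForm (Der E ps d (j + 1)) d (roundForm s) := by
  intro x hx
  obtain hx | ⟨qs, hqs, ⟨side, hside⟩, p, hp, rfl⟩ := hx
  · exact Or.inl (collectForm_le _ _ _ _ (h x hx))
  right
  rw [hE, ← shape_collectForm s.1 s.2.1, mem_ofKind_shape] at hqs
  obtain ⟨c, hc, hk, rfl⟩ := hqs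
  obtain ⟨t, ht, rfl⟩ := List.mem_map.1 hp
  refine ⟨_, List.mem_map_of_mem hc, _, List.mem_map_of_mem ht, rfl, ?_⟩
  have : c.fire d = true := by
    refine (collectForm_fire _ _ d c hc).2 ⟨hk, side, conjOf_eq_true.2 fun t ht hs => ?_⟩
    exact le_collectForm_mark _ _ d c hc t ht (h _ (holds_sides.1 hside t ht hs))
  simp [this]

/-- One round carries the marks from the occurrences to the table; in the next, every equation sees
them and fires. -/
theorem iterate_roundForm_inForm {E : List Sides} {ps : Sides} {d : Bool} (j : ℕ)
    {s : List Con × (Name → Mark) × Bool} (h : InForm (Der E ps d 0) d s)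
    (hE : E = ofKind .eq (shape s.1)) : InForm (Der E ps d j) d (roundForm^[2 * j] s) := by
  induction j with
  | zero => exact h
  | succ j ih =>
    rw [show 2 * (j + 1) = 2 + 2 * j by ring, iterate_add_apply]
    refine InTable.roundForm ih.roundForm ?_
    rw [shape_roundForm, shape_iterate_roundForm, hE]

/-- The derivation is complete after `T.length` steps, that is `2 * T.length` rounds. One more round
brings its marks into the table, and another shows them to the current constraint. -/
theorem iterate_roundForm_bad_complete {T : List Name} {n : ℕ}
    {s : List Con × (Name → Mark) × Bool} {ps : Sides} (hn : 2 * T.length + 2 ≤ n)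
    (hT : Covers T (shape s.1)) (hcur : ps ∈ ofKind .cur (shape s.1))
    (hs : ∀ d, InForm (Der (ofKind .eq (shape s.1)) ps d 0) d s)
    (h : Entails (ofKind .eq (shape s.1)) ps) : (roundForm^[n] s).2.2 = true := by
  have hmem (k : Kind) : ∀ qs ∈ ofKind k (shape s.1), ∀ p ∈ qs, p.2 ∈ T := by
    intro qs hqs
    obtain ⟨c, hc, -, rfl⟩ := mem_ofKind_shape.1 hqs
    exact hT _ (List.mem_map_of_mem hc)
  have hder := fun d => h.der (hmem .eq) (hmem .cur ps hcur) d
  -- The `k` surplus rounds are harmless, since the flag is never cleared.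
  obtain ⟨k, rfl⟩ := Nat.exists_eq_add_of_le hn
  rw [Nat.add_comm, iterate_add_apply]
  apply iterate_roundForm_bad_mono
  rw [Nat.add_comm, iterate_add_apply]
  have htab := fun d => (iterate_roundForm_inForm T.length (hs d) rfl).roundForm
  have hshape := shape_iterate_roundForm (2 * T.length) s
  generalize roundForm^[2 * T.length] s = r at htab hshape
  change (roundForm (roundForm r)).2.2 = true
  simp only [InTable] at htab
  rw [← hshape, ← shape_roundForm] at hcur
  generalize roundForm r = r' at htab hcur
  rw [← shape_collectForm r'.1 r'.2.1, mem_ofKind_shape] at hcur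
  obtain ⟨c, hc, hk, rfl⟩ := hcur
  simp only [roundForm, Bool.or_eq_true, List.any_eq_true]
  refine Or.inr ⟨c, hc, Con.bad_eq_true.2 ⟨hk, fun t ht d => ?_⟩⟩
  exact le_collectForm_mark _ _ d c hc t ht (htab d _ (forall_mem_sides.1 (hder d) t ht))

/-! #### All disequalities -/

theorem ofKind_cons (k : Kind) (c : Con) (F : List Con) :
    ofKind k (shape (c :: F)) =
      if c.kind = k then c.sides :: ofKind k (shape F) else ofKind k (shape F) := by
  by_cases h : c.kind = k <;> simp [ofKind, shape, h, Con.sides]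

theorem ofKind_eq_selectForm (b : Bool) (F : List Con) :
    ofKind .eq (shape (selectForm b F)) = ofKind .eq (shape F) := by
  induction F generalizing b with
  | nil => rfl
  | cons c F ih =>
    unfold selectForm
    rcases hk : c.kind <;> cases b <;> simp [ofKind_cons, ih, hk, startCon] <;>
      simp [Con.sides, Function.comp_def]

theorem ofKind_todo_selectForm (b : Bool) (F : List Con) :
    ofKind .todo (shape (selectForm b F)) =
      if b then ofKind .todo (shape F) else (ofKind .todo (shape F)).tail := by
  induction F generalizing b with
  | nil => cases b <;> rfl
  | cons c F ih =>
    unfold selectForm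
    rcases hk : c.kind <;> cases b <;> simp [ofKind_cons, ih, hk, startCon]
    all_goals simp [Con.sides, Function.comp_def]

theorem ofKind_cur_selectForm (b : Bool) (F : List Con) :
    ofKind .cur (shape (selectForm b F)) =
      if b then [] else (ofKind .todo (shape F)).take 1 := by
  induction F generalizing b with
  | nil => cases b <;> rfl
  | cons c F ih =>
    unfold selectForm
    rcases hk : c.kind <;> cases b <;> simp [ofKind_cons, ih, hk, startCon]
    all_goals simp [Con.sides, Function.comp_def]

theorem selectForm_mark (b : Bool) (F : List Con) : ∀ c ∈ selectForm b F, ∀ t ∈ c.toks, ∀ d,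
    (t.mark d = true ↔ c.kind = .cur ∧ d = t.side) := by
  have key (k : Kind) (b : Bool) (c : Con) (hk : b = true ↔ k = .cur) :
      ∀ t ∈ (startCon k b c).toks, ∀ d,
        (t.mark d = true ↔ (startCon k b c).kind = .cur ∧ d = t.side) := by
    intro t ht d
    obtain ⟨t, ht, rfl⟩ := List.mem_map.1 ht
    cases b <;> simp_all [startCon]
  induction F generalizing b with
  | nil => simp [selectForm]
  | cons c F ih =>
    intro c' hc'
    unfold selectForm at hc'
    rcases hk : c.kind <;> cases b <;> simp only [hk, List.mem_cons, if_true, if_false,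
      Bool.false_eq_true] at hc' <;> rcases hc' with rfl | hc' <;>
      first | exact ih _ _ hc' | exact key _ _ _ (by simp)

/-- The marks set by `selectForm` are stage 0 of both derivations for the disequality just chosen.
`take 1` also covers the case that none is left. -/
theorem checkForm_bad {T : List Name} {n : ℕ} (hn : 2 * T.length + 2 ≤ n) (F : List Con)
    (hT : Covers T (shape F)) (bad : Bool) :
    (checkForm n (F, bad)).2 = true ↔ bad = true ∨
      ∃ ps ∈ (ofKind .todo (shape F)).take 1, Entails (ofKind .eq (shape F)) ps := by
  have hc := ofKind_cur_selectForm false F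
  have he := ofKind_eq_selectForm false F
  simp only [Bool.false_eq_true, if_false] at hc
  have hmark := selectForm_mark false F
  rw [← hc, ← he]
  unfold checkForm
  constructor
  · intro h
    have h' (ps : Sides) (hps : ∀ qs ∈ ofKind .cur (shape (selectForm false F)), qs = ps) := by
      refine iterate_roundForm_bad_sound n (selectForm false F, ⊥, bad) ps hps ?_ h
      intro w d _ hd
      refine ⟨fun c hc t ht hm => ?_, fun x hx => by simp at hx⟩
      obtain ⟨hk, hs⟩ := (hmark c hc t ht d).1 hm
      rw [← hps _ (mem_ofKind_shape.2 ⟨c, hc, hk, rfl⟩)] at hd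
      exact holds_sides.1 hd t ht hs.symm
    rcases hq : ofKind .cur (shape (selectForm false F)) with _ | ⟨ps, l⟩
    · obtain h | h := h' [] (by simp [hq])
      · exact Or.inl h
      · exact absurd hq h.1
    · have hl : l = [] := by
        have := congrArg List.length hc
        rw [hq, List.length_take, List.length_cons] at this
        exact List.length_eq_zero_iff.1 (by omega)
      subst hl
      obtain h | h := h' ps (by simp [hq])
      · exact Or.inl h
      · exact Or.inr ⟨ps, by simp, h.2⟩
  · rintro (rfl | ⟨ps, hps, h⟩)
    · exact iterate_roundForm_bad_mono _ _ rfl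
    · refine iterate_roundForm_bad_complete (T := T) hn (hT.selectForm false) hps ?_ h
      intro d x hx
      right
      obtain ⟨c, hc, hk, rfl⟩ := mem_ofKind_shape.1 hps
      obtain ⟨t, ht, he⟩ := List.mem_map.1 hx
      obtain ⟨rfl, rfl⟩ := Prod.mk.inj he
      exact ⟨c, hc, t, ht, rfl, (hmark c hc t ht _).2 ⟨hk, rfl⟩⟩

/-- Each check removes the first pending disequality and keeps the equations; once none is pending,
further checks leave the flag alone. -/
theorem iterate_checkForm_bad {T : List Name} {n : ℕ} (hn : 2 * T.length + 2 ≤ n) (N : ℕ)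
    (F : List Con) (hT : Covers T (shape F)) (bad : Bool)
    (hN : (ofKind .todo (shape F)).length ≤ N) :
    ((checkForm n)^[N] (F, bad)).2 = true ↔ bad = true ∨
      ∃ ps ∈ ofKind .todo (shape F), Entails (ofKind .eq (shape F)) ps := by
  induction N generalizing F bad with
  | zero =>
    rw [List.length_eq_zero_iff.1 (Nat.le_zero.1 hN)]
    simp
  | succ N ih =>
    have hs : shape (checkForm n (F, bad)).1 = shape (selectForm false F) := by
      rw [checkForm, shape_iterate_roundForm]
    have ht := ofKind_todo_selectForm false F
    simp only [Bool.false_eq_true, if_false] at ht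
    have h := ih (checkForm n (F, bad)).1 (by rw [hs]; exact hT.selectForm false)
      (checkForm n (F, bad)).2 (by rw [hs, ht, List.length_tail]; omega)
    rw [iterate_succ_apply]
    refine h.trans ?_
    rw [checkForm_bad hn F hT, hs, ht, ofKind_eq_selectForm]
    rcases ofKind .todo (shape F) with _ | ⟨ps, l⟩ <;> simp [or_assoc]

end SemilatticeCSP

namespace SemilatticeCSP

open Function FirstOrder

/-! ### Satisfiability in the universal homogeneous semilattice -/

theorem funMap_meet {S : Type*} [meetLang.Structure S] (x : Fin 2 → S) :
    FirstOrder.Language.Structure.funMap (L := meetLang) MeetSymbol.meet x = meet (x 0) (x 1) := by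
  unfold meet
  congr 1
  funext i
  fin_cases i <;> rfl

theorem realize_meet {S : Type*} [meetLang.Structure S] (v : ℕ → S)
    (ts : Fin 2 → meetLang.Term ℕ) :
    (FirstOrder.Language.Term.func (L := meetLang) MeetSymbol.meet ts).realize v =
      meet ((ts 0).realize v) ((ts 1).realize v) :=
  funMap_meet _

theorem apply_realize {S : Type*} [meetLang.Structure S] (h : S → Bool)
    (hh : ∀ a b, h (meet a b) = (h a && h b)) (v : ℕ → S) (t : meetLang.Term ℕ) :
    h (t.realize v) = t.realize (fun n => h (v n)) := by
  induction t with
  | var n => rfl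
  | func f ts ih =>
    obtain ⟨⟩ := f
    rw [realize_meet, hh, ih, ih]
    rfl

/-- Only the set of variables of a term matters, which justifies storing terms as flat lists of
occurrences. -/
theorem realize_bool_eq_true (v : ℕ → Bool) (t : meetLang.Term ℕ) :
    t.realize v = true ↔ ∀ n ∈ termVars t, v n = true := by
  induction t with
  | var n => simp [termVars]
  | func f ts ih =>
    obtain ⟨⟩ := f
    rw [realize_meet]
    change (((ts 0).realize v && (ts 1).realize v) = true) ↔ _
    simp [termVars, ih, or_imp, forall_and]

/-- The powers of the two-element semilattice. -/
instance powerStructure (ι : Type) : meetLang.Structure (ULift.{w} (ι → Bool)) where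
  funMap := fun f v => match f, v with
    | MeetSymbol.meet, v => ⟨fun i => (v 0).down i && (v 1).down i⟩
  RelMap := fun r _ => nomatch r

theorem isSemilattice_power (ι : Type) : IsSemilattice (ULift.{w} (ι → Bool)) where
  assoc _ _ _ := congrArg ULift.up (funext fun _ => Bool.and_assoc _ _ _)
  comm _ _ := congrArg ULift.up (funext fun _ => Bool.and_comm _ _)
  idem _ := congrArg ULift.up (funext fun _ => Bool.and_self _)

/-! ### Solutions in the limit and in powers of `{0,1}` -/

section

variable {U : Type w} [meetLang.Structure U] [Countable U]
  (hU : FirstOrder.Language.IsFraisseLimit finiteSemilattices U)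

include hU

/-- Each axiom involves at most three elements, and they generate a substructure that lies in the
age, hence is a semilattice. -/
theorem isSemilattice_of_isFraisseLimit : IsSemilattice U := by
  have key (s : Set U) (hs : s.Finite) :
      IsSemilattice (FirstOrder.Language.Substructure.closure meetLang s) := by
    have h := FirstOrder.Language.age.fg_substructure (L := meetLang)
      (FirstOrder.Language.Substructure.fg_closure hs)
    rw [hU.age] at h
    exact h.2
  have coe (s : meetLang.Substructure U) (a b : s) : ((meet a b : s) : U) = meet (a : U) b := by
    refine congrArg (FirstOrder.Language.Structure.funMap (L := meetLang) MeetSymbol.meet) ?_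
    funext i
    fin_cases i <;> rfl
  refine ⟨fun a b c => ?_, fun a b => ?_, fun a => ?_⟩
  · have h := key {a, b, c} (Set.toFinite _)
    have hsub := FirstOrder.Language.Substructure.subset_closure (L := meetLang)
      (s := ({a, b, c} : Set U))
    simpa [coe] using
      congrArg Subtype.val (h.assoc ⟨a, hsub (by simp)⟩ ⟨b, hsub (by simp)⟩ ⟨c, hsub (by simp)⟩)
  · have h := key {a, b} (Set.toFinite _)
    have hsub := FirstOrder.Language.Substructure.subset_closure (L := meetLang)
      (s := ({a, b} : Set U))
    simpa [coe] using congrArg Subtype.val (h.comm ⟨a, hsub (by simp)⟩ ⟨b, hsub (by simp)⟩)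
  · have h := key {a} (Set.toFinite _)
    have hsub := FirstOrder.Language.Substructure.subset_closure (L := meetLang) (s := ({a} : Set U))
    simpa [coe] using congrArg Subtype.val (h.idem ⟨a, hsub (by simp)⟩)

theorem exists_embedding_power (ι : Type) [Finite ι] :
    Nonempty (ULift.{w} (ι → Bool) ↪[meetLang] U) := by
  have hfin : Finite (ULift.{w} (ι → Bool)) := inferInstance
  have h : (⟨ULift.{w} (ι → Bool), powerStructure ι⟩ :
      CategoryTheory.Bundled.{w} meetLang.Structure) ∈ finiteSemilattices :=
    ⟨hfin, isSemilattice_power ι⟩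
  rw [← hU.age] at h
  exact h.2

/-- Forwards, the principal filters of the order are homomorphisms to `{0,1}`. Backwards, the 0/1
solutions are combined in a power that embeds in `U`. -/
theorem satisfiable_iff (φ : List (Constraint meetLang)) :
    Satisfiable U φ ↔ ∀ s t, .ne s t ∈ φ → ∃ v : ℕ → Bool,
      (∀ a b, .eq a b ∈ φ → a.realize v = b.realize v) ∧
        ((s.realize v = false ∧ t.realize v = true) ∨
          (s.realize v = true ∧ t.realize v = false)) := by
  classical
  constructor
  · rintro ⟨v, hv⟩ s t hst
    have hs := isSemilattice_of_isFraisseLimit hU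
    let : Min U := ⟨meet⟩
    let : SemilatticeInf U := SemilatticeInf.mk' hs.comm hs.assoc hs.idem
    have hh (e a b : U) : decide (e ≤ meet a b) = (decide (e ≤ a) && decide (e ≤ b)) := by
      rw [← Bool.decide_and]
      exact decide_eq_decide.2 (le_inf_iff (α := U))
    have hne : s.realize v ≠ t.realize v := hv _ hst
    have heq (e : U) (a b : meetLang.Term ℕ) (hab : .eq a b ∈ φ) :
        a.realize (fun n => decide (e ≤ v n)) = b.realize (fun n => decide (e ≤ v n)) := by
      rw [← apply_realize (fun x => decide (e ≤ x)) (hh e) v a,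
        ← apply_realize (fun x => decide (e ≤ x)) (hh e) v b,
        show a.realize v = b.realize v from hv _ hab]
    -- If `s ≤ t` then `t ≰ s`, and the filter above `t` contains `t` but not `s`. Otherwise the
    -- filter above `s` contains `s` but not `t`.
    by_cases hle : s.realize v ≤ t.realize v
    · have hle' : ¬ t.realize v ≤ s.realize v := fun h => hne (le_antisymm hle h)
      refine ⟨fun n => decide (t.realize v ≤ v n), heq _, Or.inl ?_⟩
      rw [← apply_realize (fun x => decide (t.realize v ≤ x)) (hh _) v s,
        ← apply_realize (fun x => decide (t.realize v ≤ x)) (hh _) v t]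
      simp [hle']
    · refine ⟨fun n => decide (s.realize v ≤ v n), heq _, Or.inr ?_⟩
      rw [← apply_realize (fun x => decide (s.realize v ≤ x)) (hh _) v s,
        ← apply_realize (fun x => decide (s.realize v ≤ x)) (hh _) v t]
      simp [hle]
  · intro H
    have H' (c : {c // c ∈ φ}) : ∃ v : ℕ → Bool,
        (∀ a b, .eq a b ∈ φ → a.realize v = b.realize v) ∧
          ∀ s t, c.1 = .ne s t → s.realize v ≠ t.realize v := by
      obtain ⟨⟨a, b⟩ | ⟨s, t⟩, hc⟩ := c
      -- The coordinates are indexed by all constraints. At an equation nothing has to be separated,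
      -- and the all-ones assignment satisfies every equation.
      · refine ⟨fun _ => true, fun a b _ => ?_, by simp⟩
        rw [(realize_bool_eq_true _ a).2 (by simp), (realize_bool_eq_true _ b).2 (by simp)]
      · obtain ⟨v, hv, h⟩ := H s t hc
        refine ⟨v, hv, ?_⟩
        rintro _ _ ⟨⟩
        rcases h with ⟨h₁, h₂⟩ | ⟨h₁, h₂⟩ <;> simp [h₁, h₂]
    choose v hv hv' using H'
    have : Finite {c // c ∈ φ} := List.finite_toSet φ
    obtain ⟨f⟩ := exists_embedding_power hU {c // c ∈ φ}
    let u : ℕ → ULift.{w} ({c // c ∈ φ} → Bool) := fun n => ⟨fun c => v c n⟩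
    have hu (t : meetLang.Term ℕ) (c : {c // c ∈ φ}) : (t.realize u).down c = t.realize (v c) :=
      apply_realize (fun x : ULift.{w} ({c // c ∈ φ} → Bool) => x.down c) (fun _ _ => rfl) u t
    refine ⟨f ∘ u, fun c hc => ?_⟩
    cases c with
    | eq a b =>
      change a.realize (f ∘ u) = b.realize (f ∘ u)
      rw [FirstOrder.Language.HomClass.realize_term, FirstOrder.Language.HomClass.realize_term]
      congr 1
      refine ULift.ext _ _ (funext fun c => ?_)
      rw [hu, hu, hv c a b hc]
    | ne s t =>
      change s.realize (f ∘ u) ≠ t.realize (f ∘ u)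
      rw [FirstOrder.Language.HomClass.realize_term, FirstOrder.Language.HomClass.realize_term]
      intro h
      have := congrArg (fun x : ULift.{w} ({c // c ∈ φ} → Bool) => x.down ⟨_, hc⟩) (f.injective h)
      simp only [hu] at this
      exact hv' ⟨_, hc⟩ s t rfl this

end

/-! ### The Turing machine -/

/-- The occurrences of variables in a pair of terms. -/
def pairSides (s t : meetLang.Term ℕ) : Sides :=
  (termNames s).map (fun x => (false, x)) ++ (termNames t).map fun x => (true, x)

theorem sides_termToks (s t : meetLang.Term ℕ) (k : Kind) :
    (Con.mk k ⊥ (termToks false s ++ termToks true t)).sides = pairSides s t := by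
  simp [Con.sides, termToks, pairSides, Function.comp_def]

theorem mem_ofKind_eq {φ : List (Constraint meetLang)} {ps : Sides} :
    ps ∈ ofKind .eq (shape (φ.map conOf)) ↔ ∃ s t, .eq s t ∈ φ ∧ pairSides s t = ps := by
  rw [mem_ofKind_shape]
  constructor
  · rintro ⟨_, hc, hk, rfl⟩
    obtain ⟨⟨s, t⟩ | ⟨s, t⟩, hc', rfl⟩ := List.mem_map.1 hc
    · exact ⟨s, t, hc', (sides_termToks s t .eq).symm⟩
    · cases hk
  · rintro ⟨s, t, h, rfl⟩
    exact ⟨_, List.mem_map_of_mem h, rfl, sides_termToks s t .eq⟩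

theorem mem_ofKind_todo {φ : List (Constraint meetLang)} {ps : Sides} :
    ps ∈ ofKind .todo (shape (φ.map conOf)) ↔ ∃ s t, .ne s t ∈ φ ∧ pairSides s t = ps := by
  rw [mem_ofKind_shape]
  constructor
  · rintro ⟨_, hc, hk, rfl⟩
    obtain ⟨⟨s, t⟩ | ⟨s, t⟩, hc', rfl⟩ := List.mem_map.1 hc
    · cases hk
    · exact ⟨s, t, hc', (sides_termToks s t .todo).symm⟩
  · rintro ⟨s, t, h, rfl⟩
    exact ⟨_, List.mem_map_of_mem h, rfl, sides_termToks s t .todo⟩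

section

variable {w : Name → Prop} {v : ℕ → Bool} (h : ∀ n, w (Computability.encodeNat n) ↔ v n = true)

include h

theorem holds_pairSides_false (s t : meetLang.Term ℕ) :
    Holds w (pairSides s t) false ↔ s.realize v = true := by
  simp [Holds, pairSides, realize_bool_eq_true, termNames, or_imp, forall_and, h]

theorem holds_pairSides_true (s t : meetLang.Term ℕ) :
    Holds w (pairSides s t) true ↔ t.realize v = true := by
  simp [Holds, pairSides, realize_bool_eq_true, termNames, or_imp, forall_and, h]

theorem eqSat_iff (φ : List (Constraint meetLang)) :
    EqSat (ofKind .eq (shape (φ.map conOf))) w ↔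
      ∀ a b, .eq a b ∈ φ → a.realize v = b.realize v := by
  constructor
  · intro H a b hab
    have := H _ (mem_ofKind_eq.2 ⟨a, b, hab, rfl⟩)
    rwa [holds_pairSides_false h, holds_pairSides_true h, ← Bool.eq_iff_iff] at this
  · intro H ps hps
    obtain ⟨a, b, hab, rfl⟩ := mem_ofKind_eq.1 hps
    rw [holds_pairSides_false h, holds_pairSides_true h, H a b hab]

end

/-- Sets of names and 0/1 assignments correspond through the binary code of the indices. A failure
of entailment is an assignment under which one side is 1 and the other is 0. -/
theorem not_entails_iff (φ : List (Constraint meetLang)) (s t : meetLang.Term ℕ) :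
    ¬ Entails (ofKind .eq (shape (φ.map conOf))) (pairSides s t) ↔ ∃ v : ℕ → Bool,
      (∀ a b, .eq a b ∈ φ → a.realize v = b.realize v) ∧
        ((s.realize v = false ∧ t.realize v = true) ∨
          (s.realize v = true ∧ t.realize v = false)) := by
  classical
  constructor
  · intro H
    simp only [Entails, not_forall] at H
    obtain ⟨w, hw, d, hd, p, hp, hpw⟩ := H
    let v : ℕ → Bool := fun n => decide (w (Computability.encodeNat n))
    have hv (n : ℕ) : w (Computability.encodeNat n) ↔ v n = true := by simp [v]
    refine ⟨v, (eqSat_iff hv φ).1 hw, ?_⟩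
    -- The side of the failing name is not entirely in `w`, so it is not `d` but the opposite side.
    have h' : ¬ Holds w (pairSides s t) p.1 := fun h => hpw (h p hp rfl)
    have hne : p.1 ≠ d := by rintro rfl; exact h' hd
    generalize p.1 = e at h' hne
    cases d <;> cases e <;> simp only [ne_eq, not_true_eq_false, holds_pairSides_false hv,
      holds_pairSides_true hv, Bool.not_eq_true] at hd h' hne
    · exact Or.inr ⟨hd, h'⟩
    · exact Or.inl ⟨h', hd⟩
  · rintro ⟨v, hv, h⟩ H
    let w : Name → Prop := fun x => v (Computability.decodeNat x) = true
    have hw (n : ℕ) : w (Computability.encodeNat n) ↔ v n = true := by simp [w]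
    have H' := fun d hd e => show Holds w (pairSides s t) e from
      fun p hp _ => H w ((eqSat_iff hw φ).2 hv) d hd p hp
    rcases h with ⟨h₁, h₂⟩ | ⟨h₁, h₂⟩
    · have := (holds_pairSides_false hw s t).1 (H' true ((holds_pairSides_true hw s t).2 h₂) false)
      simp [h₁] at this
    · have := (holds_pairSides_true hw s t).1 (H' false ((holds_pairSides_false hw s t).2 h₁) true)
      simp [h₂] at this

/-! ### The length of the word bounds the number of rounds and checks -/

theorem length_termNames_le (t : meetLang.Term ℕ) : (termNames t).length ≤ (encodeTerm t).length := by
  induction t with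
  | var n => simp [termNames, termVars, encodeTerm]
  | func f ts ih =>
    obtain ⟨⟩ := f
    have h₀ := ih 0
    have h₁ := ih 1
    simp only [termNames, List.length_map] at h₀ h₁
    simp only [termNames, List.length_map, termVars, encodeTerm, List.length_append,
      List.length_cons]
    omega

theorem length_conNames_lt (c : Constraint meetLang) :
    (conNames c).length + 1 ≤ (encodeConstraint c).length := by
  rcases c with ⟨s, t⟩ | ⟨s, t⟩ <;>
  · have hs := length_termNames_le s
    have ht := length_termNames_le t
    simp only [conNames, encodeConstraint, List.length_append, List.length_cons]
    omega

theorem length_instance_le (φ : List (Constraint meetLang)) :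
    (φ.flatMap conNames).length + φ.length ≤ (encodeInstance φ).length := by
  induction φ with
  | nil => simp
  | cons c φ ih =>
    have := length_conNames_lt c
    simp only [encodeInstance, List.flatMap_cons, List.length_append, List.length_cons] at ih ⊢
    omega

theorem length_ofKind_le (k : Kind) (F : List Con) : (ofKind k (shape F)).length ≤ F.length := by
  simpa [ofKind, shape] using List.length_filter_le (fun c => decide (c.1 = k)) (shape F)

/-- The names and constraints together number at most the length of the word. So four rounds per
letter exceed `2 * T.length + 2` for a nonempty instance, and one check per letter reaches every
disequality. -/
theorem solve_bad {U : Type w} [meetLang.Structure U] [Countable U]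
    (hU : FirstOrder.Language.IsFraisseLimit finiteSemilattices U)
    (φ : List (Constraint meetLang)) :
    ((checkForm (4 * (encodeInstance φ).length))^[(encodeInstance φ).length]
      (φ.map conOf, false)).2 = true ↔ ¬ Satisfiable U φ := by
  rcases φ.eq_nil_or_concat' with rfl | hφ
  -- The empty word allows no rounds, so the bound fails; but no check is made and the instance is
  -- satisfiable.
  · simp [encodeInstance, satisfiable_iff hU]
  have hpos : 0 < φ.length := by
    obtain ⟨l, c, rfl⟩ := hφ
    simp
  have hlen := length_instance_le φ
  have htodo := length_ofKind_le .todo (φ.map conOf)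
  rw [List.length_map] at htodo
  rw [iterate_checkForm_bad (T := φ.flatMap conNames) (by omega) _ _ (covers_instance φ) _ (by omega),
    satisfiable_iff hU]
  simp only [Bool.false_eq_true, false_or, ← not_entails_iff, mem_ofKind_todo]
  push Not
  constructor
  · rintro ⟨_, ⟨s, t, hst, rfl⟩, h⟩
    exact ⟨s, t, hst, h⟩
  · rintro ⟨s, t, hst, h⟩
    exact ⟨_, ⟨s, t, hst, rfl⟩, h⟩

theorem decidableInPolyTime_satisfiable {U : Type w} [meetLang.Structure U] [Countable U]
    (hU : FirstOrder.Language.IsFraisseLimit finiteSemilattices U) :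
    DecidableInPolyTime encodeInstance (fun φ => Satisfiable U φ) := by
  classical
  -- This Boolean function is defined classically; its computability comes from the stack program.
  refine ⟨fun φ => decide (Satisfiable U φ), fun φ => decide_eq_true_iff, ?_⟩
  refine StackProg.computableInPolyTime Stk.inp Stk.out solve wt (fun k => by cases k <;> first | decide | exact le_rfl)
    wf_solve {} (fun v => !v.bad) (Equiv.refl Letter) (Equiv.refl Bool) _ _ _ fun φ => ?_
  have h : (encodeInstance φ).map (Equiv.refl Letter).symm = encodeInstance φ := List.map_id _
  have hs := den_solve φ
  rw [← h] at hs
  rw [hs]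
  refine ⟨rfl, ?_⟩
  have hb := solve_bad hU φ
  by_cases hsat : Satisfiable U φ
  · simp_all [st, Computability.encodeBool]
  · simp_all [st, Computability.encodeBool]

end SemilatticeCSP

theorem mainTheorem9 {U : Type*} [SemilatticeCSP.meetLang.Structure U] [Countable U]
    (hU : FirstOrder.Language.IsFraisseLimit SemilatticeCSP.finiteSemilattices U) :
    SemilatticeCSP.DecidableInPolyTime SemilatticeCSP.encodeInstance
      (fun φ => SemilatticeCSP.Satisfiable U φ) ∧
    (∀ E D : List (SemilatticeCSP.meetLang.Term ℕ × SemilatticeCSP.meetLang.Term ℕ),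
      SemilatticeCSP.Satisfiable U (E.map (fun e => .eq e.1 e.2) ++ D.map (fun d => .ne d.1 d.2)) ↔
        ∀ d ∈ D, SemilatticeCSP.Satisfiable U (E.map (fun e => .eq e.1 e.2) ++ [.ne d.1 d.2])) ∧
    (∀ (E : List (SemilatticeCSP.meetLang.Term ℕ × SemilatticeCSP.meetLang.Term ℕ))
      (s t : SemilatticeCSP.meetLang.Term ℕ),
      SemilatticeCSP.Satisfiable U (E.map (fun e => .eq e.1 e.2) ++ [.ne s t]) ↔
        ∃ v : ℕ → Bool, (∀ e ∈ E, e.1.realize v = e.2.realize v) ∧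
          ((s.realize v = false ∧ t.realize v = true) ∨
            (s.realize v = true ∧ t.realize v = false))) := by
  refine ⟨SemilatticeCSP.decidableInPolyTime_satisfiable hU, fun E D => ?_, fun E s t => ?_⟩
  -- The criterion treats each disequality separately against the same equations, so only list
  -- memberships remain to be compared.
  · simp only [SemilatticeCSP.satisfiable_iff hU]
    simp
  · simp only [SemilatticeCSP.satisfiable_iff hU]
    simp
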